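/- Let $H$ and $H'$ be complex Hilbert spaces and let $p\in(1,\infty)\setminus\{2\}$. Let $C_p(H)$ be the Schatten class of all compact operators $a$ on $H$ with $\|a\|_p=\big(\sum_n \sigma_n(a)^p\big)^{1/p}<\infty$, where $(\sigma_n(a))_n$ are the singular values of $a$ (the eigenvalues of $|a|=(a^*a)^{1/2}$, repeated according to multiplicity), and let $S(C_p(H))$ be its unit sphere. A minimal partial isometry is an operator $e$ of rank one with $ee^*e=e$. For a minimal partial isometry $e$ put $P_2(e)(x)=ee^*\,x\,e^*e$ and $P_0(e)(x)=(1-ee^*)\,x\,(1-e^*e)$, and let $\varphi_e(x)$ be the unique complex number with $P_2(e)(x)=\varphi_e(x)\,e$. Let $\Delta:S(C_p(H))\to S(C_p(H'))$ be a surjective isometry, that is, a surjective map with $\|\Delta(x)-\Delta(y)\|_p=\|x-y\|_p$ for all $x,y\in S(C_p(H))$, and let $e,v\in S(C_p(H))$ be minimal partial isometries. Then $\Delta(e)$ is a minimal partial isometry, $$P_2(\Delta(e))(\Delta(v))\in\big\{\varphi_e(v)\,\Delta(e),\ \overline{\varphi_e(v)}\,\Delta(e)\big\},$$ equivalently, $\varphi_{\Delta(e)}(\Delta(v))\in\{\varphi_e(v),\overline{\varphi_e(v)}\}$,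 and $$\|P_0(\Delta(e))(\Delta(v))\|_p=\|P_0(e)(v)\|_p .$$ -/

import Mathlib

noncomputable section

section

variable {H : Type*} [NormedAddCommGroup H] [InnerProductSpace ℂ H] [CompleteSpace H]

/-- The multiplicity of `s` as a singular value of a compact operator `a`: the dimension of the
eigenspace of `|a| = (a* a)^(1/2)` for the eigenvalue `s`. For compact `a` and `s > 0` this
eigenspace is finite dimensional. -/
def singularMultiplicity (a : H →L[ℂ] H) (s : ℝ) : ℕ :=
  Module.finrank ℂ
    (Module.End.eigenspace ((CFC.abs a : H →L[ℂ] H) : H →ₗ[ℂ] H) (s : ℂ))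

/-- The Schatten `p`-norm of a compact operator `a`, with values in `[0, ∞]`: `‖a‖_p ^ p` is the sum
of the `p`-th powers of the nonzero singular values of `a`, repeated according to multiplicity. -/
def schattenNorm (p : ℝ) (a : H →L[ℂ] H) : ENNReal :=
  (∑' s : {s : ℝ // 0 < s},
    (singularMultiplicity a (s : ℝ) : ENNReal) * ENNReal.ofReal (s : ℝ) ^ p) ^ (1 / p)

variable (H) in
/-- The Schatten class `C_p(H)`. -/
def schattenClass (p : ℝ) : Set (H →L[ℂ] H) :=
  {a | IsCompactOperator a ∧ schattenNorm p a < ⊤}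

variable (H) in
/-- The unit sphere `S(C_p(H))`. -/
def schattenSphere (p : ℝ) : Set (H →L[ℂ] H) :=
  {a | a ∈ schattenClass H p ∧ schattenNorm p a = 1}

/-- A minimal partial isometry: a partial isometry (`e e* e = e`) of rank one. -/
def IsMinimalPartialIsometry (e : H →L[ℂ] H) : Prop :=
  e * star e * e = e ∧ Module.finrank ℂ (LinearMap.range (e : H →ₗ[ℂ] H)) = 1

/-- The Peirce projection `P_2(e)(x) = e e* x e* e`. -/
def peirceTwo (e x : H →L[ℂ] H) : H →L[ℂ] H :=
  e * star e * x * (star e * e)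

/-- The Peirce projection `P_0(e)(x) = (1 - e e*) x (1 - e* e)`. -/
def peirceZero (e x : H →L[ℂ] H) : H →L[ℂ] H :=
  (1 - e * star e) * x * (1 - star e * e)

/-- For a minimal partial isometry `e` there is exactly one complex number `c` with
`P_2(e)(x) = c e`. -/
theorem IsMinimalPartialIsometry.existsUnique_coeff {e : H →L[ℂ] H}
    (he : IsMinimalPartialIsometry e) (x : H →L[ℂ] H) :
    ∃! c : ℂ, peirceTwo e x = c • e := by
  obtain ⟨-, h1⟩ := he
  obtain ⟨⟨v, hv⟩, hv0, hspan⟩ := finrank_eq_one_iff'.1 h1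
  have hs : ∀ y : H, ∃ c : ℂ, c • v = e y := fun y => by
    obtain ⟨c, hc⟩ := hspan ⟨e y, ⟨y, rfl⟩⟩
    exact ⟨c, congrArg Subtype.val hc⟩
  have hv0' : v ≠ 0 := fun h => hv0 (Subtype.ext h)
  obtain ⟨c, hc⟩ := hs (star e (x (star e v)))
  have hP : peirceTwo e x = c • e := by
    ext y
    obtain ⟨d, hd⟩ := hs y
    change e (star e (x (star e (e y)))) = c • e y
    rw [← hd]
    simp only [map_smul]
    rw [← hc, smul_comm]
  refine ⟨c, hP, fun d hd => ?_⟩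
  obtain ⟨y, hy⟩ := hv
  have h2 : d • e y = c • e y := congrArg (fun T : H →L[ℂ] H => T y) (hd.symm.trans hP)
  have hy' : e y = v := hy
  rw [hy'] at h2
  exact smul_left_injective ℂ hv0' h2

open Classical in
/-- The coefficient `φ_e(x)`: for a minimal partial isometry `e`, the unique complex number with
`P_2(e)(x) = φ_e(x) e` (and `0` if `e` is not a minimal partial isometry). -/
def peirceCoeff (e x : H →L[ℂ] H) : ℂ :=
  if he : IsMinimalPartialIsometry e then (he.existsUnique_coeff x).choose else 0

end

end

/-! The argument shows that the distance on the sphere remembers three things: antipodes,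
orthogonality, and enough spectral data of a pair of rank-one operators.

Antipodes: by strict convexity, points of the sphere at distance 2 are opposite
(`eq_neg_of_schattenSum_sub_eq`), so Δ(-x) = -Δ(x), and Δ preserves ‖x + y‖ as well as ‖x - y‖.

Orthogonality: for p ≠ 2, equality in the Clarkson type inequality, ‖x+y‖^p + ‖x-y‖^p = 2(‖x‖^p +
‖y‖^p), characterises x*y = 0 = yx* (`schattenSum_parallelogram_iff`). Hence Δ preserves
orthogonality in both directions. Rank-one operators are recognised from orthogonality alone, as
those whose annihilator is maximal (`exists_eq_rankOne_of_isOrtho_maximal`,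
`exists_eq_smul_of_isOrtho_imp`); so Δ(e) is a minimal partial isometry and Δ(ie) is a unimodular
multiple of Δ(e).

Spectral data: write e = f ⊗ u and v = g ⊗ w, with φ = φ_e(v) = ⟨f,g⟩⟨w,u⟩. Counting zeros, at most
two eigenvalues of (e ∓ v)*(e ∓ v) matter; their sum is 2 ∓ 2 Re φ and their product is D = (1 -
|⟨f,g⟩|²)(1 - |⟨w,u⟩|²) for both signs. The two norms ‖e ∓ v‖_p give the sums of the (p/2)-th
powers, and for p ≠ 2 these determine Re φ and D (`IsPowerSum.eq_and_eq`). Since ‖P_0(e)(v)‖_p = √D,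
the last claim follows. The same invariance for the pair e, ie forces Δ(ie) = ±iΔ(e); for the pair
ie, v it preserves Im φ up to that sign. -/

noncomputable section

set_option linter.unusedSectionVars false
set_option linter.unusedSimpArgs false

open scoped InnerProductSpace InnerProduct

/-! ### Sums of powers of singular values, and their computation in an eigenbasis. -/

section SchattenSum

variable {E F : Type*} [NormedAddCommGroup E] [InnerProductSpace ℂ E] [CompleteSpace E]
  [NormedAddCommGroup F] [InnerProductSpace ℂ F] [CompleteSpace F]

open ContinuousLinearMap Module.End

/-- The sum of the `p`-th powers of the singular values of an operator between Hilbert spaces. -/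
def schattenSum (p : ℝ) (T : E →L[ℂ] F) : ENNReal :=
  ∑' s : {s : ℝ // 0 < s},
    (Module.finrank ℂ (eigenspace ((T† ∘L T : E →L[ℂ] E) : E →ₗ[ℂ] E) (((s : ℝ) ^ 2 : ℝ) : ℂ)) :
      ENNReal) * ENNReal.ofReal (s : ℝ) ^ p

/-- If |a|²h = s²h, then k = |a|h - sh satisfies (|a| + s)k = 0, and positivity of |a| with s > 0
gives k = 0. This trades |a| for a*a, which also makes sense for operators between different spaces.
-/
theorem eigenspace_cfcAbs (a : E →L[ℂ] E) {s : ℝ} (hs : 0 < s) :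
    eigenspace ((CFC.abs a : E →L[ℂ] E) : E →ₗ[ℂ] E) (s : ℂ) =
      eigenspace ((a† ∘L a : E →L[ℂ] E) : E →ₗ[ℂ] E) ((s ^ 2 : ℝ) : ℂ) := by
  have hsq : ∀ h : E, CFC.abs a (CFC.abs a h) = (a†) (a h) := fun h => by
    have := congrArg (fun T : E →L[ℂ] E => T h) (CFC.abs_mul_abs a)
    simpa [star_eq_adjoint] using this
  ext h
  simp only [mem_eigenspace_iff, coe_coe, coe_comp, Function.comp_apply]
  constructor
  · intro hh
    rw [← hsq, hh, map_smul, hh, smul_smul]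
    push_cast
    rw [sq]
  · intro hh
    have hpos : (CFC.abs a).IsPositive := (nonneg_iff_isPositive _).1 (CFC.abs_nonneg a)
    set k := CFC.abs a h - (s : ℂ) • h with hk
    have h0 : CFC.abs a k + (s : ℂ) • k = 0 := by
      rw [hk, map_sub, map_smul, hsq, hh, smul_sub, smul_smul]
      push_cast
      rw [sq]
      abel
    have h1 : RCLike.re ⟪CFC.abs a k, k⟫_ℂ + s * ‖k‖ ^ 2 = 0 := by
      have := congrArg (fun z => RCLike.re ⟪z, k⟫_ℂ) h0
      simpa [inner_add_left, inner_smul_left, inner_self_eq_norm_sq_to_K, ← Complex.ofReal_pow]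
        using this
    have h2 : 0 ≤ RCLike.re ⟪CFC.abs a k, k⟫_ℂ := hpos.re_inner_nonneg_left k
    have h3 : ‖k‖ ^ 2 = 0 := by nlinarith [sq_nonneg ‖k‖]
    have h4 : k = 0 := by simpa using h3
    exact sub_eq_zero.1 h4

theorem schattenNorm_eq_schattenSum_rpow (p : ℝ) (a : E →L[ℂ] E) :
    schattenNorm p a = schattenSum p a ^ (1 / p) := by
  unfold schattenNorm schattenSum singularMultiplicity
  congr 2
  ext s
  rw [eigenspace_cfcAbs a s.2]

theorem schattenSum_congr {F' : Type*} [NormedAddCommGroup F'] [InnerProductSpace ℂ F']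
    [CompleteSpace F'] (p : ℝ) {S : E →L[ℂ] F} {T : E →L[ℂ] F'}
    (h : S† ∘L S = T† ∘L T) : schattenSum p S = schattenSum p T := by
  unfold schattenSum
  rw [h]

/-- T† and c⁻¹T are mutually inverse between the two eigenspaces. -/
theorem finrank_eigenspace_comp_adjoint (T : E →L[ℂ] F) {c : ℂ} (hc : c ≠ 0) :
    Module.finrank ℂ (eigenspace ((T ∘L T† : F →L[ℂ] F) : F →ₗ[ℂ] F) c) =
    Module.finrank ℂ (eigenspace ((T† ∘L T : E →L[ℂ] E) : E →ₗ[ℂ] E) c) := by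
  refine LinearEquiv.finrank_eq (LinearEquiv.ofLinearMap
    (((T† : F →L[ℂ] E) : F →ₗ[ℂ] E).restrict ?_) (c⁻¹ • ((T : E →ₗ[ℂ] F).restrict ?_)) ?_ ?_)
  · intro x hx
    simp only [mem_eigenspace_iff, coe_coe, coe_comp, Function.comp_apply] at hx ⊢
    rw [hx, map_smul]
  · intro x hx
    simp only [mem_eigenspace_iff, coe_coe, coe_comp, Function.comp_apply] at hx ⊢
    rw [hx, map_smul]
  · refine LinearMap.ext fun x => Subtype.ext ?_
    have hx : (T†) (T x) = c • (x : E) := mem_eigenspace_iff.1 x.2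
    change (T†) (c⁻¹ • T x) = x
    rw [map_smul, hx, inv_smul_smul₀ hc]
  · refine LinearMap.ext fun x => Subtype.ext ?_
    have hx : T ((T†) x) = c • (x : F) := mem_eigenspace_iff.1 x.2
    change c⁻¹ • T ((T†) x) = x
    rw [hx, inv_smul_smul₀ hc]

theorem schattenSum_adjoint (p : ℝ) (T : E →L[ℂ] F) : schattenSum p (T†) = schattenSum p T := by
  unfold schattenSum
  congr 1
  ext s
  rw [adjoint_adjoint, finrank_eigenspace_comp_adjoint T]
  have := s.2
  exact_mod_cast (by positivity : (s : ℝ) ^ 2 ≠ 0)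

theorem HilbertBasis.eq_of_inner_eq {ι : Type*} (b : HilbertBasis ι ℂ E) {x y : E}
    (h : ∀ i, ⟪b i, x⟫_ℂ = ⟪b i, y⟫_ℂ) : x = y := by
  apply b.repr.injective
  ext i
  simpa [b.repr_apply_apply] using h i

theorem HilbertBasis.hasSum_sq_norm_inner {ι : Type*} (b : HilbertBasis ι ℂ E) (x : E) :
    HasSum (fun i => ‖⟪b i, x⟫_ℂ‖ ^ 2) (‖x‖ ^ 2) := by
  have h := b.hasSum_inner_mul_inner x x
  rw [inner_self_eq_norm_sq_to_K] at h
  have h2 : (fun i => ⟪x, b i⟫_ℂ * ⟪b i, x⟫_ℂ) = fun i => ((‖⟪b i, x⟫_ℂ‖ ^ 2 : ℝ) : ℂ) := by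
    ext i
    rw [← inner_conj_symm x (b i), RCLike.conj_mul]
    simp
  rw [h2] at h
  have h : HasSum (fun i => ((‖⟪b i, x⟫_ℂ‖ ^ 2 : ℝ) : ℂ)) ((‖x‖ ^ 2 : ℝ) : ℂ) := by simpa using h
  exact Complex.hasSum_ofReal.1 h

theorem norm_sq_of_adjoint_apply_eq_smul (T : E →L[ℂ] F) {x : E} (hx : ‖x‖ = 1) {c : ℂ}
    (h : (T†) (T x) = c • x) : c = ((‖T x‖ ^ 2 : ℝ) : ℂ) := by
  have := congrArg (fun z => ⟪x, z⟫_ℂ) h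
  simp only [adjoint_inner_right, inner_self_eq_norm_sq_to_K, inner_smul_right, hx] at this
  push_cast
  simpa using this.symm

/-- Group the basis by the value s = ‖T b_i‖: for s > 0 the fibre is a basis of the
(finite-dimensional) eigenspace of T†T at s², so its cardinality is the multiplicity. -/
theorem schattenSum_eq_tsum {ι : Type*} {p : ℝ} (hp : 0 < p) {T : E →L[ℂ] F}
    (hT : IsCompactOperator T) (b : HilbertBasis ι ℂ E)
    (hb : ∀ i, ∃ c : ℂ, (T†) (T (b i)) = c • b i) :
    schattenSum p T = ∑' i, ‖T (b i)‖ₑ ^ p := by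
  have hb' : ∀ i, (T†) (T (b i)) = ((‖T (b i)‖ ^ 2 : ℝ) : ℂ) • b i := fun i => by
    obtain ⟨c, hc⟩ := hb i
    rw [← norm_sq_of_adjoint_apply_eq_smul T (b.orthonormal.1 i) hc, hc]
  have hA : IsCompactOperator (T† ∘L T : E →L[ℂ] E) := hT.clm_comp (T†)
  have key : ∀ s : ℝ, 0 < s → (Module.finrank ℂ
      (eigenspace ((T† ∘L T : E →L[ℂ] E) : E →ₗ[ℂ] E) ((s ^ 2 : ℝ) : ℂ)) : ENNReal) *
        ENNReal.ofReal s ^ p =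
      ∑' i : (fun i => ‖T (b i)‖) ⁻¹' {s}, ‖T (b i)‖ₑ ^ p := by
    intro s hs
    set V := eigenspace ((T† ∘L T : E →L[ℂ] E) : E →ₗ[ℂ] E) ((s ^ 2 : ℝ) : ℂ) with hV
    have hs2 : ((s ^ 2 : ℝ) : ℂ) ≠ 0 := by exact_mod_cast (by positivity : s ^ 2 ≠ 0)
    have : FiniteDimensional ℂ V := finite_dimensional_eigenspace hA _ hs2
    set J := (fun i => ‖T (b i)‖) ⁻¹' {s} with hJ
    have hmem : ∀ i : J, b i ∈ V := fun i => by
      rw [hV, mem_eigenspace_iff]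
      have := i.2
      simp only [hJ, Set.mem_preimage, Set.mem_singleton_iff] at this
      change (T†) (T (b i)) = _
      rw [hb', this]
    have hli : LinearIndependent ℂ (fun i : J => (⟨b i, hmem i⟩ : V)) := by
      apply LinearIndependent.of_comp V.subtype
      exact b.orthonormal.linearIndependent.comp _ Subtype.val_injective
    have : Finite J := hli.finite
    have := Fintype.ofFinite J
    have hspan : ⊤ ≤ Submodule.span ℂ (Set.range (fun i : J => (⟨b i, hmem i⟩ : V))) := by
      rintro ⟨x, hx⟩ -
      have hxs : x = ∑ i : J, ⟪b i, x⟫_ℂ • b i := by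
        apply b.eq_of_inner_eq
        intro k
        rw [inner_sum]
        by_cases hk : k ∈ J
        · rw [Finset.sum_eq_single (⟨k, hk⟩ : J)]
          · simp [inner_smul_right, inner_self_eq_norm_sq_to_K, b.orthonormal.1 k]
          · intro j _ hj
            rw [inner_smul_right, b.orthonormal.2, mul_zero]
            exact fun h => hj (Subtype.ext h.symm)
          · simp
        · rw [Finset.sum_eq_zero]
          · have h1 : ⟪b k, (T†) (T x)⟫_ℂ = ((s ^ 2 : ℝ) : ℂ) * ⟪b k, x⟫_ℂ := by
              rw [hV, mem_eigenspace_iff] at hx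
              rw [← inner_smul_right]
              exact congrArg _ hx
            have h2 : ⟪b k, (T†) (T x)⟫_ℂ = ((‖T (b k)‖ ^ 2 : ℝ) : ℂ) * ⟪b k, x⟫_ℂ := by
              rw [adjoint_inner_right, ← adjoint_inner_left, hb', inner_smul_left,
                Complex.conj_ofReal]
            rw [h1] at h2
            by_contra h0
            have h3 := mul_right_cancel₀ h0 h2
            have h4 : s ^ 2 = ‖T (b k)‖ ^ 2 := by exact_mod_cast h3
            exact hk ((pow_left_inj₀ hs.le (norm_nonneg _) two_ne_zero).1 h4).symm
          · intro j _
            rw [inner_smul_right, b.orthonormal.2, mul_zero]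
            rintro rfl
            exact hk j.2
      have : (⟨x, hx⟩ : V) = ∑ i : J, ⟪b i, x⟫_ℂ • (⟨b i, hmem i⟩ : V) := by
        apply Subtype.ext
        simpa using hxs
      rw [this]
      exact Submodule.sum_mem _ fun i _ =>
        Submodule.smul_mem _ _ (Submodule.subset_span ⟨i, rfl⟩)
    have hcard : Module.finrank ℂ V = Fintype.card J :=
      Module.finrank_eq_card_basis (Module.Basis.mk hli hspan)
    have hterm : ∀ i : J, ‖T (b i)‖ₑ ^ p = ENNReal.ofReal s ^ p := fun i => by
      have h : ‖T (b i)‖ = s := i.2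
      rw [← ofReal_norm, h]
    rw [tsum_congr hterm, hcard, tsum_fintype]
    simp
  unfold schattenSum
  rw [← ENNReal.tsum_fiberwise _ (fun i => ‖T (b i)‖)]
  rw [tsum_congr (fun s : {s : ℝ // 0 < s} => key s s.2)]
  -- Fibres over s ≤ 0 contain only kernel vectors of T and contribute nothing.
  refine tsum_subtype_eq_of_support_subset
    (f := fun s : ℝ => ∑' i : (fun i => ‖T (b i)‖) ⁻¹' {s}, ‖T (b i)‖ₑ ^ p) (s := {s | 0 < s}) ?_
  intro s hs
  by_contra hs0
  apply hs
  simp only [Set.mem_ofPred_eq, not_lt] at hs0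
  refine ENNReal.tsum_eq_zero.2 fun i => ?_
  have h : ‖T (b i)‖ = s := i.2
  have : T (b i) = 0 := by
    rw [← norm_eq_zero]
    exact le_antisymm (h.le.trans hs0) (norm_nonneg _)
  simp [this, hp]

end SchattenSum

/-! ### Eigenbases of T†T for compact T, and compactness of the adjoint. -/

section SchattenSum

variable {E F : Type*} [NormedAddCommGroup E] [InnerProductSpace ℂ E] [CompleteSpace E]
  [NormedAddCommGroup F] [InnerProductSpace ℂ F] [CompleteSpace F]

open ContinuousLinearMap Module.End

universe u v
theorem OrthogonalFamily.exists_hilbertBasis_mem {E : Type u} [NormedAddCommGroup E]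
    [InnerProductSpace ℂ E] [CompleteSpace E] {κ : Type v} {V : κ → Submodule ℂ E}
    (hV : OrthogonalFamily ℂ (fun k => V k) fun k => (V k).subtypeₗᵢ)
    (hc : ∀ k, IsClosed (V k : Set E)) (hbot : (⨆ k, V k)ᗮ = ⊥) :
    ∃ (ι : Type (max u v)) (b : HilbertBasis ι ℂ E), ∀ i, ∃ k, b i ∈ V k := by
  have : ∀ k, CompleteSpace (V k) := fun k => (hc k).completeSpace_coe
  choose w b hb using fun k => exists_hilbertBasis ℂ (V k)
  have hon := hV.orthonormal_sigma_orthonormal (fun k => (b k).orthonormal)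
  generalize hv : (fun a : Σ k, w k => (V a.1).subtypeₗᵢ (b a.1 a.2)) = v at hon
  have hv' : ∀ k i, v ⟨k, i⟩ = (b k i : E) := fun k i => by rw [← hv]; rfl
  have hbot2 : (Submodule.span ℂ (Set.range v))ᗮ = ⊥ := by
    rw [eq_bot_iff, ← hbot]
    intro x hx
    rw [← Submodule.iInf_orthogonal]
    simp only [Submodule.mem_iInf]
    intro k y hy
    have h3 : ∀ i, ⟪x, (b k i : E)⟫_ℂ = 0 := fun i => by
      rw [← inner_conj_symm, hx (b k i : E) (Submodule.subset_span ⟨⟨k, i⟩, hv' k i⟩), map_zero]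
    have h2 : HasSum (fun i => (b k).repr ⟨y, hy⟩ i * ⟪x, (b k i : E)⟫_ℂ) ⟪x, y⟫_ℂ := by
      have h1 := ((innerSL ℂ x).comp (V k).subtypeL).hasSum ((b k).hasSum_repr ⟨y, hy⟩)
      simpa [inner_smul_right] using h1
    simp only [h3, mul_zero] at h2
    rw [← inner_conj_symm, h2.unique hasSum_zero, map_zero]
  refine ⟨_, HilbertBasis.mkOfOrthogonalEqBot hon hbot2, fun i => ⟨i.1, ?_⟩⟩
  rw [HilbertBasis.coe_mkOfOrthogonalEqBot, hv' i.1 i.2]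
  exact (b i.1 i.2).2

theorem exists_eigenbasis {E : Type u} [NormedAddCommGroup E] [InnerProductSpace ℂ E]
    [CompleteSpace E] {T : E →L[ℂ] F} (hT : IsCompactOperator T) :
    ∃ (ι : Type u) (b : HilbertBasis ι ℂ E),
      ∀ i, (T†) (T (b i)) = ((‖T (b i)‖ ^ 2 : ℝ) : ℂ) • b i := by
  have hA : IsCompactOperator (T† ∘L T : E →L[ℂ] E) := hT.clm_comp (T†)
  have hs : ((T† ∘L T : E →L[ℂ] E) : E →ₗ[ℂ] E).IsSymmetric := by
    intro x y
    simp [adjoint_inner_left, adjoint_inner_right]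
  generalize hAT : (T† ∘L T : E →L[ℂ] E) = A at hA hs
  have hV : ∀ μ : ℂ, IsClosed ((eigenspace (A : E →ₗ[ℂ] E) μ : Submodule ℂ E) : Set E) := by
    intro μ
    have : ((eigenspace (A : E →ₗ[ℂ] E) μ : Submodule ℂ E) : Set E) = {x | A x = μ • x} := by
      ext x
      simp
    rw [this]
    exact isClosed_eq A.continuous (continuous_const_smul μ)
  obtain ⟨ι, b, hb⟩ := hs.orthogonalFamily_eigenspaces.exists_hilbertBasis_mem hV
    (orthogonalComplement_iSup_eigenspaces_eq_bot hA hs)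
  refine ⟨ι, b, fun i => ?_⟩
  obtain ⟨μ, h⟩ := hb i
  have h1 : (T†) (T (b i)) = μ • b i := by
    rw [← mem_eigenspace_iff.1 h, ← hAT]
    rfl
  rw [← norm_sq_of_adjoint_apply_eq_smul T (b.orthonormal.1 i) h1]
  exact h1

/-- Schauder's theorem from ‖T†z‖² ≤ ‖z‖ ‖TT†z‖: a finite net for the image of the ball under TT†
yields one for T†. -/
theorem IsCompactOperator.adjoint {T : E →L[ℂ] F} (hT : IsCompactOperator T) :
    IsCompactOperator (T†) := by
  have hS : IsCompactOperator (T ∘L T† : F →L[ℂ] F) := hT.comp_clm (T†)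
  have hS' := ((isCompactOperator_iff_isCompact_closure_image_ball
    (T ∘L T† : F →L[ℂ] F).toLinearMap zero_lt_one).1 hS).totallyBounded.subset subset_closure
  refine (isCompactOperator_iff_isCompact_closure_image_ball (T† : F →L[ℂ] E).toLinearMap
    zero_lt_one).2 ?_
  refine (TotallyBounded.closure ?_).isCompact_of_isClosed isClosed_closure
  rw [Metric.totallyBounded_iff]
  intro ε hε
  -- Differences of points of the unit ball have norm below 2, so ε²/2 for TT† becomes ε² for the
  -- squared norm under T†.
  obtain ⟨t, ht, htf, hcov⟩ := Metric.finite_approx_of_totallyBounded hS' (ε ^ 2 / 2)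
    (by positivity)
  have ht' : ∀ y ∈ t, ∃ z, z ∈ Metric.ball (0 : F) 1 ∧ T ((T†) z) = y := fun y hy => ht hy
  choose! g hg hgt using ht'
  refine ⟨(fun y => (T†) (g y)) '' t, htf.image _, ?_⟩
  rintro _ ⟨x, hx, rfl⟩
  obtain ⟨y, hy, hxy⟩ := Set.mem_iUnion₂.1 (hcov ⟨x, hx, rfl⟩)
  refine Set.mem_iUnion₂.2 ⟨_, ⟨y, hy, rfl⟩, ?_⟩
  rw [← hgt y hy, Metric.mem_ball, dist_eq_norm] at hxy
  have hgy := hg y hy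
  rw [mem_ball_zero_iff] at hx hgy
  change ‖T ((T†) x) - T ((T†) (g y))‖ < _ at hxy
  rw [Metric.mem_ball, dist_eq_norm]
  change ‖(T†) x - (T†) (g y)‖ < ε
  rw [← map_sub] at hxy ⊢
  rw [← map_sub] at hxy
  have h1 : ‖(T†) (x - g y)‖ ^ 2 ≤ ‖x - g y‖ * ‖T ((T†) (x - g y))‖ := by
    have h := norm_inner_le_norm (𝕜 := ℂ) (x - g y) (T ((T†) (x - g y)))
    rw [← adjoint_inner_left, inner_self_eq_norm_sq_to_K] at h
    simpa using h
  have h2 : ‖x - g y‖ < 2 := by linarith [norm_sub_le x (g y)]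
  have h3 : ‖(T†) (x - g y)‖ ^ 2 < ε ^ 2 := by
    nlinarith [norm_nonneg (T ((T†) (x - g y))), norm_nonneg (x - g y)]
  exact lt_of_pow_lt_pow_left₀ 2 hε.le h3

end SchattenSum

/-! ### Jensen's inequality for doubly (sub)stochastic arrays, with equality cases. -/

section Jensen

theorem Real.rpow_tangent_lt {r c t : ℝ} (hr : 1 < r) (hc : 0 ≤ c) (ht : 0 ≤ t) (h : t ≠ c) :
    c ^ r + r * c ^ (r - 1) * (t - c) < t ^ r := by
  rcases hc.eq_or_lt with rfl | hc
  · rw [Real.zero_rpow (by linarith), Real.zero_rpow (by linarith)]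
    have : 0 < t := lt_of_le_of_ne ht (Ne.symm h)
    simpa using Real.rpow_pos_of_pos this r
  · have h1 := one_add_mul_self_lt_rpow_one_add (s := t / c - 1) (by
      have : 0 ≤ t / c := by positivity
      linarith) (by
      intro h0
      apply h
      field_simp at h0
      linarith) hr
    have h2 : (1 + (t / c - 1)) ^ r = t ^ r / c ^ r := by
      rw [← Real.div_rpow ht hc.le]
      congr 1
      ring
    rw [h2, lt_div_iff₀ (by positivity)] at h1
    have h3 : c ^ r = c ^ (r - 1) * c := by
      rw [← Real.rpow_add_one hc.ne']
      simp
    calc c ^ r + r * c ^ (r - 1) * (t - c) = (1 + r * (t / c - 1)) * c ^ r := by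
          rw [h3]
          field_simp
      _ < t ^ r := h1

theorem Real.lt_rpow_tangent {r c t : ℝ} (hr0 : 0 < r) (hr : r < 1) (hc : 0 < c) (ht : 0 ≤ t)
    (h : t ≠ c) : t ^ r < c ^ r + r * c ^ (r - 1) * (t - c) := by
  have h1 := rpow_one_add_lt_one_add_mul_self (s := t / c - 1) (by
    have : 0 ≤ t / c := by positivity
    linarith) (by
    intro h0
    apply h
    field_simp at h0
    linarith) hr0 hr
  have h2 : (1 + (t / c - 1)) ^ r = t ^ r / c ^ r := by
    rw [← Real.div_rpow ht hc.le]
    congr 1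
    ring
  rw [h2, div_lt_iff₀ (by positivity)] at h1
  have h3 : c ^ r = c ^ (r - 1) * c := by
    rw [← Real.rpow_add_one hc.ne']
    simp
  calc t ^ r < (1 + r * (t / c - 1)) * c ^ r := h1
    _ = c ^ r + r * c ^ (r - 1) * (t - c) := by
        rw [h3]
        field_simp

variable {ι κ : Type*} {r C : ℝ} {M t : κ → ℝ}

theorem summable_mul_of_le_const (hM0 : ∀ k, 0 ≤ M k) (hM : Summable M) (ht0 : ∀ k, 0 ≤ t k)
    (htC : ∀ k, t k ≤ C) : Summable fun k => M k * t k :=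
  Summable.of_nonneg_of_le (fun k => mul_nonneg (hM0 k) (ht0 k))
    (fun k => mul_le_mul_of_nonneg_left (htC k) (hM0 k)) (hM.mul_right C)

theorem tsum_mul_rpow_sub_tangent (hr0 : 0 < r) (hM0 : ∀ k, 0 ≤ M k) (hM : Summable M)
    (ht0 : ∀ k, 0 ≤ t k) (htC : ∀ k, t k ≤ C) (c : ℝ) :
    HasSum (fun k => M k * (t k ^ r - (c ^ r + r * c ^ (r - 1) * (t k - c))))
      (∑' k, M k * t k ^ r - ((∑' k, M k) * c ^ r +
        r * c ^ (r - 1) * ((∑' k, M k * t k) - (∑' k, M k) * c))) := by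
  have h1 := (summable_mul_of_le_const hM0 hM (fun k => Real.rpow_nonneg (ht0 k) r)
    (fun k => Real.rpow_le_rpow (ht0 k) (htC k) hr0.le)).hasSum
  have h2 := (summable_mul_of_le_const hM0 hM ht0 htC).hasSum
  have h3 := hM.hasSum
  convert! h1.sub ((h3.mul_right (c ^ r)).add
    ((h2.sub (h3.mul_right c)).mul_left (r * c ^ (r - 1)))) using 1
  ext k
  ring

/-- Sum the tangent-line inequality at the mean c. Total mass below 1 is harmless for r > 1: the
missing mass only adds the nonnegative slack (r - 1)(1 - ∑ M)c^r. -/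
theorem rpow_tsum_mul_le (hr : 1 < r) (hM0 : ∀ k, 0 ≤ M k) (hM : Summable M)
    (hM1 : ∑' k, M k ≤ 1) (ht0 : ∀ k, 0 ≤ t k) (htC : ∀ k, t k ≤ C) :
    (∑' k, M k * t k) ^ r ≤ ∑' k, M k * t k ^ r ∧
      ((∑' k, M k * t k) ^ r = ∑' k, M k * t k ^ r →
        ∀ k, M k ≠ 0 → t k = ∑' k, M k * t k) := by
  set c := ∑' k, M k * t k with hc
  have hc0 : 0 ≤ c := tsum_nonneg fun k => mul_nonneg (hM0 k) (ht0 k)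
  have hs := tsum_mul_rpow_sub_tangent (by linarith : 0 < r) hM0 hM ht0 htC c
  rw [← hc] at hs
  have hcr : c ^ (r - 1) * c = c ^ r := by
    rcases hc0.eq_or_lt with h | h
    · rw [← h, Real.zero_rpow (by linarith : r ≠ 0), mul_zero]
    · rw [← Real.rpow_add_one h.ne']
      simp
  have hg : ∀ k, 0 ≤ M k * (t k ^ r - (c ^ r + r * c ^ (r - 1) * (t k - c))) := fun k => by
    refine mul_nonneg (hM0 k) (sub_nonneg.2 ?_)
    by_cases h : t k = c
    · simp [h]
    · exact (Real.rpow_tangent_lt hr hc0 (ht0 k) h).le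
  have hcr0 : 0 ≤ c ^ r := Real.rpow_nonneg hc0 r
  have hv : ∑' k, M k * t k ^ r - ((∑' k, M k) * c ^ r +
        r * c ^ (r - 1) * (c - (∑' k, M k) * c)) =
      ∑' k, M k * t k ^ r - c ^ r - (r - 1) * (1 - ∑' k, M k) * c ^ r := by
    linear_combination (-r * (1 - ∑' k, M k)) * hcr
  rw [hv] at hs
  have hnn : 0 ≤ (r - 1) * (1 - ∑' k, M k) * c ^ r :=
    mul_nonneg (mul_nonneg (by linarith) (by linarith)) hcr0
  have h0 := hs.nonneg hg
  refine ⟨by linarith, fun he k hk => ?_⟩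
  have h1 : ∑' k, M k * t k ^ r - c ^ r - (r - 1) * (1 - ∑' k, M k) * c ^ r = 0 := by linarith
  rw [h1, hasSum_zero_iff_of_nonneg hg] at hs
  by_contra h
  have h2 := congrFun hs k
  rcases mul_eq_zero.1 h2 with h3 | h3
  · exact hk h3
  · linarith [Real.rpow_tangent_lt hr hc0 (ht0 k) h]

/-- In the concave case missing mass would have the wrong sign, so total mass exactly 1 is required;
mean zero is treated apart because t^r has no tangent line at 0. -/
theorem tsum_mul_rpow_le (hr0 : 0 < r) (hr : r < 1) (hM0 : ∀ k, 0 ≤ M k) (hM : Summable M)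
    (hM1 : ∑' k, M k = 1) (ht0 : ∀ k, 0 ≤ t k) (htC : ∀ k, t k ≤ C) :
    ∑' k, M k * t k ^ r ≤ (∑' k, M k * t k) ^ r ∧
      (∑' k, M k * t k ^ r = (∑' k, M k * t k) ^ r →
        ∀ k, M k ≠ 0 → t k = ∑' k, M k * t k) := by
  set c := ∑' k, M k * t k with hc
  have hMt0 : ∀ k, 0 ≤ M k * t k := fun k => mul_nonneg (hM0 k) (ht0 k)
  have hc0 : 0 ≤ c := tsum_nonneg hMt0
  rcases hc0.eq_or_lt with hcz | hcpos
  · have h1 : ∀ k, M k ≠ 0 → t k = 0 := by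
      have h2 := (summable_mul_of_le_const hM0 hM ht0 htC).hasSum
      rw [← hc, ← hcz, hasSum_zero_iff_of_nonneg hMt0] at h2
      exact fun k hk => (mul_eq_zero.1 (congrFun h2 k)).resolve_left hk
    rw [← hcz, Real.zero_rpow hr0.ne']
    refine ⟨le_of_eq ?_, fun _ k hk => h1 k hk⟩
    rw [← tsum_zero (α := ℝ) (β := κ)]
    congr 1
    ext k
    by_cases hk : M k = 0
    · simp [hk]
    · simp [h1 k hk, Real.zero_rpow hr0.ne']
  have hs := tsum_mul_rpow_sub_tangent hr0 hM0 hM ht0 htC c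
  rw [← hc, hM1] at hs
  have hg : ∀ k, M k * (t k ^ r - (c ^ r + r * c ^ (r - 1) * (t k - c))) ≤ 0 := fun k => by
    refine mul_nonpos_of_nonneg_of_nonpos (hM0 k) (sub_nonpos.2 ?_)
    by_cases h : t k = c
    · simp [h]
    · exact (Real.lt_rpow_tangent hr0 hr hcpos (ht0 k) h).le
  have hv : ∑' k, M k * t k ^ r - (1 * c ^ r + r * c ^ (r - 1) * (c - 1 * c)) =
      ∑' k, M k * t k ^ r - c ^ r := by ring
  rw [hv] at hs
  have h0 := hs.nonpos hg
  refine ⟨by linarith, fun he k hk => ?_⟩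
  rw [he, sub_self] at hs
  have hs' := hs.neg
  rw [neg_zero, hasSum_zero_iff_of_nonneg (fun k => neg_nonneg.2 (hg k))] at hs'
  by_contra h
  have h2 := congrFun hs' k
  simp only [Pi.zero_apply, neg_eq_zero] at h2
  rcases mul_eq_zero.1 h2 with h3 | h3
  · exact hk h3
  · linarith [Real.lt_rpow_tangent hr0 hr hcpos (ht0 k) h]

theorem ENNReal.eq_of_tsum_eq_of_le {f g : ι → ENNReal} (hfg : ∀ i, f i ≤ g i)
    (h : ∑' i, f i = ∑' i, g i) (hf : ∑' i, f i ≠ ⊤) (i : ι) : f i = g i := by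
  by_contra hne
  exact (ENNReal.tsum_lt_tsum hf hfg (lt_of_le_of_ne (hfg i) hne)).ne h

variable {A : ι → κ → ℝ}

theorem tsum_ofReal_tsum_mul_rpow (hr0 : 0 < r) (hA0 : ∀ i k, 0 ≤ A i k)
    (hA : ∀ i, Summable (A i)) (ht0 : ∀ k, 0 ≤ t k) (htC : ∀ k, t k ≤ C) :
    ∑' i, ENNReal.ofReal (∑' k, A i k * t k ^ r) =
      ∑' k, (∑' i, ENNReal.ofReal (A i k)) * ENNReal.ofReal (t k ^ r) := by
  simp_rw [← ENNReal.tsum_mul_right]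
  rw [ENNReal.tsum_comm]
  congr 1
  ext i
  rw [ENNReal.ofReal_tsum_of_nonneg
    (fun k => mul_nonneg (hA0 i k) (Real.rpow_nonneg (ht0 k) r))
    (summable_mul_of_le_const (hA0 i) (hA i) (fun k => Real.rpow_nonneg (ht0 k) r)
      (fun k => Real.rpow_le_rpow (ht0 k) (htC k) hr0.le))]
  simp_rw [ENNReal.ofReal_mul (hA0 i _)]

/-- Jensen in each row, then exchange the sums and use the column bounds. Equality makes every row
an equality case, so `t` is constant on the support of each row. -/
theorem tsum_rpow_tsum_mul_le (hr : 1 < r) (hA0 : ∀ i k, 0 ≤ A i k)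
    (hA : ∀ i, Summable (A i)) (hrow : ∀ i, ∑' k, A i k ≤ 1)
    (hcol : ∀ k, ∑' i, ENNReal.ofReal (A i k) ≤ 1)
    (ht0 : ∀ k, 0 ≤ t k) (htC : ∀ k, t k ≤ C) :
    ∑' i, ENNReal.ofReal ((∑' k, A i k * t k) ^ r) ≤ ∑' k, ENNReal.ofReal (t k ^ r) ∧
      (∑' i, ENNReal.ofReal ((∑' k, A i k * t k) ^ r) = ∑' k, ENNReal.ofReal (t k ^ r) →
        ∑' k, ENNReal.ofReal (t k ^ r) ≠ ⊤ →
          ∀ i k, A i k ≠ 0 → t k = ∑' k, A i k * t k) := by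
  have hj := fun i => rpow_tsum_mul_le hr (hA0 i) (hA i) (hrow i) ht0 htC
  have h1 : ∀ i, ENNReal.ofReal ((∑' k, A i k * t k) ^ r) ≤
      ENNReal.ofReal (∑' k, A i k * t k ^ r) := fun i => ENNReal.ofReal_le_ofReal (hj i).1
  have h2 : ∑' i, ENNReal.ofReal (∑' k, A i k * t k ^ r) ≤ ∑' k, ENNReal.ofReal (t k ^ r) := by
    rw [tsum_ofReal_tsum_mul_rpow (by linarith) hA0 hA ht0 htC]
    refine ENNReal.tsum_le_tsum fun k => ?_
    calc _ ≤ 1 * ENNReal.ofReal (t k ^ r) := by gcongr; exact hcol k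
      _ = _ := one_mul _
  refine ⟨(ENNReal.tsum_le_tsum h1).trans h2, fun he hf i k hik => (hj i).2 ?_ k hik⟩
  have h3 := ENNReal.eq_of_tsum_eq_of_le h1
    (le_antisymm (ENNReal.tsum_le_tsum h1) (h2.trans he.ge)) (he ▸ hf) i
  rwa [ENNReal.ofReal_eq_ofReal_iff (Real.rpow_nonneg (tsum_nonneg fun k =>
    mul_nonneg (hA0 i k) (ht0 k)) r) (tsum_nonneg fun k =>
    mul_nonneg (hA0 i k) (Real.rpow_nonneg (ht0 k) r))] at h3

theorem tsum_rpow_le_tsum_rpow_tsum_mul (hr0 : 0 < r) (hr : r < 1) (hA0 : ∀ i k, 0 ≤ A i k)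
    (hA : ∀ i, Summable (A i)) (hrow : ∀ i, ∑' k, A i k = 1)
    (hcol : ∀ k, ∑' i, ENNReal.ofReal (A i k) = 1)
    (ht0 : ∀ k, 0 ≤ t k) (htC : ∀ k, t k ≤ C) :
    ∑' k, ENNReal.ofReal (t k ^ r) ≤ ∑' i, ENNReal.ofReal ((∑' k, A i k * t k) ^ r) ∧
      (∑' k, ENNReal.ofReal (t k ^ r) = ∑' i, ENNReal.ofReal ((∑' k, A i k * t k) ^ r) →
        ∑' k, ENNReal.ofReal (t k ^ r) ≠ ⊤ →
          ∀ i k, A i k ≠ 0 → t k = ∑' k, A i k * t k) := by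
  have hj := fun i => tsum_mul_rpow_le hr0 hr (hA0 i) (hA i) (hrow i) ht0 htC
  have h1 : ∀ i, ENNReal.ofReal (∑' k, A i k * t k ^ r) ≤
      ENNReal.ofReal ((∑' k, A i k * t k) ^ r) := fun i => ENNReal.ofReal_le_ofReal (hj i).1
  have h2 : ∑' i, ENNReal.ofReal (∑' k, A i k * t k ^ r) = ∑' k, ENNReal.ofReal (t k ^ r) := by
    rw [tsum_ofReal_tsum_mul_rpow hr0 hA0 hA ht0 htC]
    simp_rw [hcol, one_mul]
  rw [← h2]
  refine ⟨ENNReal.tsum_le_tsum h1, fun he hf i k hik => (hj i).2 ?_ k hik⟩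
  have h3 := ENNReal.eq_of_tsum_eq_of_le h1 he hf i
  rwa [ENNReal.ofReal_eq_ofReal_iff (tsum_nonneg fun k =>
    mul_nonneg (hA0 i k) (Real.rpow_nonneg (ht0 k) r)) (Real.rpow_nonneg (tsum_nonneg fun k =>
    mul_nonneg (hA0 i k) (ht0 k)) r)] at h3

end Jensen

/-! ### Diagonal sums in an arbitrary orthonormal basis against singular values. -/

section Comparison

variable {E F : Type*} [NormedAddCommGroup E] [InnerProductSpace ℂ E] [CompleteSpace E]
  [NormedAddCommGroup F] [InnerProductSpace ℂ F] [CompleteSpace F]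

open ContinuousLinearMap

theorem enorm_rpow_eq_ofReal {G : Type*} [NormedAddCommGroup G] (x : G) {p : ℝ} (hp : 0 < p) :
    ‖x‖ₑ ^ p = ENNReal.ofReal ((‖x‖ ^ 2) ^ (p / 2)) := by
  rw [← Real.rpow_natCast, ← Real.rpow_mul (norm_nonneg x), ← ofReal_norm,
    ENNReal.ofReal_rpow_of_nonneg (norm_nonneg x) hp.le]
  congr 2
  push_cast
  ring

theorem hasSum_sq_norm_apply {κ : Type*} {T : E →L[ℂ] F} (w : HilbertBasis κ ℂ E)
    (hw : ∀ k, (T†) (T (w k)) = ((‖T (w k)‖ ^ 2 : ℝ) : ℂ) • w k) (u : E) :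
    HasSum (fun k => ‖⟪w k, u⟫_ℂ‖ ^ 2 * ‖T (w k)‖ ^ 2) (‖T u‖ ^ 2) := by
  have h := w.hasSum_inner_mul_inner u ((T†) (T u))
  have h1 : ⟪u, (T†) (T u)⟫_ℂ = ((‖T u‖ ^ 2 : ℝ) : ℂ) := by
    rw [adjoint_inner_right, inner_self_eq_norm_sq_to_K]
    simp
  have h2 : (fun k => ⟪u, w k⟫_ℂ * ⟪w k, (T†) (T u)⟫_ℂ) =
      fun k => ((‖⟪w k, u⟫_ℂ‖ ^ 2 * ‖T (w k)‖ ^ 2 : ℝ) : ℂ) := by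
    ext k
    rw [adjoint_inner_right, ← adjoint_inner_left, hw, inner_smul_left, Complex.conj_ofReal,
      ← inner_conj_symm u (w k), mul_left_comm, RCLike.conj_mul]
    push_cast
    exact mul_comm _ _
  rw [h1, h2] at h
  exact Complex.hasSum_ofReal.1 h

theorem adjoint_apply_apply_of_inner_ne_zero {κ : Type*} {T : E →L[ℂ] F} (w : HilbertBasis κ ℂ E)
    (hw : ∀ k, (T†) (T (w k)) = ((‖T (w k)‖ ^ 2 : ℝ) : ℂ) • w k) {u : E} {c : ℝ}
    (h : ∀ k, ⟪w k, u⟫_ℂ ≠ 0 → ‖T (w k)‖ ^ 2 = c) : (T†) (T u) = (c : ℂ) • u := by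
  refine w.eq_of_inner_eq fun k => ?_
  rw [adjoint_inner_right, ← adjoint_inner_left, hw, inner_smul_left, Complex.conj_ofReal,
    inner_smul_right]
  by_cases hk : ⟪w k, u⟫_ℂ = 0
  · simp [hk]
  · rw [h k hk]

theorem tsum_ofReal_sq_norm_inner {ι : Type*} (u : HilbertBasis ι ℂ E) (x : E) :
    ∑' i, ENNReal.ofReal (‖⟪x, u i⟫_ℂ‖ ^ 2) = ENNReal.ofReal (‖x‖ ^ 2) := by
  simp_rw [norm_inner_symm x]
  rw [← ENNReal.ofReal_tsum_of_nonneg (fun i => by positivity)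
    (u.hasSum_sq_norm_inner x).summable, (u.hasSum_sq_norm_inner x).tsum_eq]

/-- With w an eigenbasis, ‖T u_i‖² is the average of the ‖T w_k‖² with the doubly stochastic weights
|⟨w_k, u_i⟩|²; apply Jensen with exponent p/2 > 1. In the equality case each u_i meets only one
eigenspace of T†T. -/
theorem tsum_enorm_rpow_le_schattenSum {ι : Type*} {p : ℝ} (hp : 2 < p) {T : E →L[ℂ] F}
    (hT : IsCompactOperator T) (u : HilbertBasis ι ℂ E) :
    ∑' i, ‖T (u i)‖ₑ ^ p ≤ schattenSum p T ∧
      (∑' i, ‖T (u i)‖ₑ ^ p = schattenSum p T → schattenSum p T ≠ ⊤ →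
        ∀ i, (T†) (T (u i)) = ((‖T (u i)‖ ^ 2 : ℝ) : ℂ) • u i) := by
  obtain ⟨κ, w, hw⟩ := exists_eigenbasis hT
  have hp0 : 0 < p := by linarith
  have key := tsum_rpow_tsum_mul_le (r := p / 2) (C := ‖T‖ ^ 2)
    (A := fun i k => ‖⟪w k, u i⟫_ℂ‖ ^ 2) (t := fun k => ‖T (w k)‖ ^ 2) (by linarith)
    (fun i k => by positivity) (fun i => (w.hasSum_sq_norm_inner (u i)).summable)
    (fun i => by rw [(w.hasSum_sq_norm_inner (u i)).tsum_eq, u.orthonormal.1 i]; norm_num)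
    (fun k => by rw [tsum_ofReal_sq_norm_inner, w.orthonormal.1 k]; norm_num)
    (fun k => by positivity) (fun k => by
      have h := T.le_opNorm (w k)
      rw [w.orthonormal.1 k, mul_one] at h
      gcongr)
  simp_rw [(hasSum_sq_norm_apply w hw _).tsum_eq, ← enorm_rpow_eq_ofReal _ hp0] at key
  rw [← schattenSum_eq_tsum hp0 hT w fun k => ⟨_, hw k⟩] at key
  exact ⟨key.1, fun h1 h2 i => adjoint_apply_apply_of_inner_ne_zero w hw fun k hk =>
    key.2 h1 h2 i k (by simpa using hk)⟩

theorem schattenSum_le_tsum_enorm_rpow {ι : Type*} {p : ℝ} (hp0 : 0 < p) (hp : p < 2)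
    {T : E →L[ℂ] F} (hT : IsCompactOperator T) (u : HilbertBasis ι ℂ E) :
    schattenSum p T ≤ ∑' i, ‖T (u i)‖ₑ ^ p ∧
      (schattenSum p T = ∑' i, ‖T (u i)‖ₑ ^ p → schattenSum p T ≠ ⊤ →
        ∀ i, (T†) (T (u i)) = ((‖T (u i)‖ ^ 2 : ℝ) : ℂ) • u i) := by
  obtain ⟨κ, w, hw⟩ := exists_eigenbasis hT
  have key := tsum_rpow_le_tsum_rpow_tsum_mul (r := p / 2) (C := ‖T‖ ^ 2)
    (A := fun i k => ‖⟪w k, u i⟫_ℂ‖ ^ 2) (t := fun k => ‖T (w k)‖ ^ 2)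
    (by linarith) (by linarith)
    (fun i k => by positivity) (fun i => (w.hasSum_sq_norm_inner (u i)).summable)
    (fun i => by rw [(w.hasSum_sq_norm_inner (u i)).tsum_eq, u.orthonormal.1 i]; norm_num)
    (fun k => by rw [tsum_ofReal_sq_norm_inner, w.orthonormal.1 k]; norm_num)
    (fun k => by positivity) (fun k => by
      have h := T.le_opNorm (w k)
      rw [w.orthonormal.1 k, mul_one] at h
      gcongr)
  simp_rw [(hasSum_sq_norm_apply w hw _).tsum_eq, ← enorm_rpow_eq_ofReal _ hp0] at key
  rw [← schattenSum_eq_tsum hp0 hT w fun k => ⟨_, hw k⟩] at key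
  exact ⟨key.1, fun h1 h2 i => adjoint_apply_apply_of_inner_ne_zero w hw fun k hk =>
    key.2 h1 h2 i k (by simpa using hk)⟩

end Comparison

/-! ### The column operator and the equality case of the Clarkson inequality. -/

section Column

variable {E F : Type*} [NormedAddCommGroup E] [InnerProductSpace ℂ E] [CompleteSpace E]
  [NormedAddCommGroup F] [InnerProductSpace ℂ F] [CompleteSpace F]

open ContinuousLinearMap

/-- The column operator `h ↦ (x h, y h)` into the Hilbert space direct sum. -/
def columnOp (x y : E →L[ℂ] F) : E →L[ℂ] WithLp 2 (F × F) :=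
  (WithLp.prodContinuousLinearEquiv 2 ℂ F F).symm.toContinuousLinearMap ∘L (x.prod y)

theorem columnOp_apply (x y : E →L[ℂ] F) (h : E) :
    columnOp x y h = WithLp.toLp 2 (x h, y h) := rfl

theorem adjoint_columnOp_apply (x y : E →L[ℂ] F) (φ : WithLp 2 (F × F)) :
    ((columnOp x y)†) φ = (x†) φ.fst + (y†) φ.snd := by
  refine ext_inner_left ℂ fun h => ?_
  rw [adjoint_inner_right, inner_add_right, adjoint_inner_right, adjoint_inner_right,
    columnOp_apply, WithLp.prod_inner_apply]
  rfl

theorem adjoint_comp_columnOp (x y : E →L[ℂ] F) :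
    (columnOp x y)† ∘L columnOp x y = x† ∘L x + y† ∘L y := by
  ext h
  simp [adjoint_columnOp_apply, columnOp_apply]

theorem norm_sq_columnOp_apply (x y : E →L[ℂ] F) (h : E) :
    ‖columnOp x y h‖ ^ 2 = ‖x h‖ ^ 2 + ‖y h‖ ^ 2 := by
  rw [WithLp.prod_norm_sq_eq_of_L2]
  rfl

theorem IsCompactOperator.columnOp {x y : E →L[ℂ] F} (hx : IsCompactOperator x)
    (hy : IsCompactOperator y) : IsCompactOperator (columnOp x y) := by
  have h1 := hx.clm_comp ((WithLp.prodContinuousLinearEquiv 2 ℂ F F).symm.toContinuousLinearMap ∘L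
    ContinuousLinearMap.inl ℂ F F)
  have h2 := hy.clm_comp ((WithLp.prodContinuousLinearEquiv 2 ℂ F F).symm.toContinuousLinearMap ∘L
    ContinuousLinearMap.inr ℂ F F)
  convert! h1.add h2 using 1
  ext h
  simp [columnOp_apply, ← WithLp.toLp_add]

theorem HilbertBasis.exists_withLp_prod {ι κ : Type*} (b : HilbertBasis ι ℂ F)
    (c : HilbertBasis κ ℂ F) : ∃ φ : HilbertBasis (ι ⊕ κ) ℂ (WithLp 2 (F × F)),
      (∀ i, φ (Sum.inl i) = WithLp.toLp 2 (b i, 0)) ∧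
      ∀ k, φ (Sum.inr k) = WithLp.toLp 2 (0, c k) := by
  set v : ι ⊕ κ → WithLp 2 (F × F) :=
    Sum.elim (fun i => WithLp.toLp 2 (b i, 0)) (fun k => WithLp.toLp 2 (0, c k)) with hv
  have hon : Orthonormal ℂ v := by
    constructor
    · rintro (i | k)
      · simp [hv, b.orthonormal.1 i]
      · simp [hv, c.orthonormal.1 k]
    · rintro (i | k) (j | l) hij
      · simpa [hv] using b.orthonormal.2 (fun h => hij (congrArg _ h))
      · simp [hv]
      · simp [hv]
      · simpa [hv] using c.orthonormal.2 (fun h => hij (congrArg _ h))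
  have hbot : (Submodule.span ℂ (Set.range v))ᗮ = ⊥ := by
    rw [eq_bot_iff]
    intro z hz
    have h1 : z.fst = 0 := b.eq_of_inner_eq fun i => by
      simpa [hv] using hz (v (Sum.inl i)) (Submodule.subset_span ⟨_, rfl⟩)
    have h2 : z.snd = 0 := c.eq_of_inner_eq fun k => by
      simpa [hv] using hz (v (Sum.inr k)) (Submodule.subset_span ⟨_, rfl⟩)
    rw [Submodule.mem_bot, ← norm_eq_zero, ← sq_eq_zero_iff, WithLp.prod_norm_sq_eq_of_L2, h1, h2]
    simp
  refine ⟨HilbertBasis.mkOfOrthogonalEqBot hon hbot, fun i => ?_, fun k => ?_⟩ <;>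
    rw [HilbertBasis.coe_mkOfOrthogonalEqBot, hv] <;> rfl

universe u
-- For C the column of x and y, CC† is the 2 × 2 block operator with diagonal blocks xx†, yy† and
-- off-diagonal blocks xy†, yx†. Eigenbases of the diagonal blocks together form φ; it is an
-- eigenbasis of CC† when the off-diagonal blocks vanish.
theorem exists_hilbertBasis_schattenSum_add_eq {F : Type u} [NormedAddCommGroup F]
    [InnerProductSpace ℂ F] [CompleteSpace F] {p : ℝ} (hp : 0 < p) {x y : E →L[ℂ] F}
    (hx : IsCompactOperator x) (hy : IsCompactOperator y) :
    ∃ (ι κ : Type u) (b : HilbertBasis ι ℂ F) (φ : HilbertBasis (ι ⊕ κ) ℂ (WithLp 2 (F × F))),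
      (∀ i, φ (Sum.inl i) = WithLp.toLp 2 (b i, 0)) ∧
      schattenSum p x + schattenSum p y = ∑' j, ‖((columnOp x y)†) (φ j)‖ₑ ^ p ∧
      ((∀ h, x ((y†) h) = 0) → (∀ h, y ((x†) h) = 0) →
        ∀ j, ∃ c : ℂ, columnOp x y (((columnOp x y)†) (φ j)) = c • φ j) := by
  obtain ⟨ι, b, hb⟩ := exists_eigenbasis hx.adjoint
  obtain ⟨κ, c, hc⟩ := exists_eigenbasis hy.adjoint
  obtain ⟨φ, hφb, hφc⟩ := b.exists_withLp_prod c
  have hb' : ∀ i, ((columnOp x y)†) (φ (Sum.inl i)) = (x†) (b i) := fun i => by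
    rw [adjoint_columnOp_apply, hφb]
    simp
  have hc' : ∀ i, ((columnOp x y)†) (φ (Sum.inr i)) = (y†) (c i) := fun i => by
    rw [adjoint_columnOp_apply, hφc]
    simp
  rw [adjoint_adjoint] at hb hc
  refine ⟨ι, κ, b, φ, hφb, ?_, ?_⟩
  · rw [Summable.tsum_sum ENNReal.summable ENNReal.summable]
    simp_rw [hb', hc']
    rw [← schattenSum_adjoint p x, ← schattenSum_adjoint p y,
      schattenSum_eq_tsum hp hx.adjoint b fun i => ⟨_, by rw [adjoint_adjoint]; exact hb i⟩,
      schattenSum_eq_tsum hp hy.adjoint c fun i => ⟨_, by rw [adjoint_adjoint]; exact hc i⟩]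
  · rintro hxy hyx (i | k)
    · refine ⟨((‖(x†) (b i)‖ ^ 2 : ℝ) : ℂ), ?_⟩
      rw [hb', columnOp_apply, hyx, hb, hφb, ← WithLp.toLp_smul]
      simp
    · refine ⟨((‖(y†) (c k)‖ ^ 2 : ℝ) : ℂ), ?_⟩
      rw [hc', columnOp_apply, hxy, hc, hφc, ← WithLp.toLp_smul]
      simp

theorem comp_adjoint_eq_zero_of_columnOp {ι κ : Type*} {x y : E →L[ℂ] F} (b : HilbertBasis ι ℂ F)
    {φ : HilbertBasis (ι ⊕ κ) ℂ (WithLp 2 (F × F))}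
    (hφ : ∀ i, φ (Sum.inl i) = WithLp.toLp 2 (b i, 0))
    (h : ∀ j, ∃ c : ℂ, columnOp x y (((columnOp x y)†) (φ j)) = c • φ j) :
    y ∘L x† = 0 := by
  have h0 : ∀ i, y ((x†) (b i)) = 0 := fun i => by
    obtain ⟨c, hc⟩ := h (Sum.inl i)
    have h1 := congrArg WithLp.snd hc
    rw [hφ, adjoint_columnOp_apply, columnOp_apply] at h1
    simpa using h1
  ext z
  refine (b.hasSum_repr z |>.mapL (y ∘L x†)).unique ?_
  simp [h0]

theorem two_mul_rpow_le {r a b : ℝ} (hr : 1 ≤ r) (ha : 0 ≤ a) (hb : 0 ≤ b) :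
    2 * ((a + b) / 2) ^ r ≤ a ^ r + b ^ r := by
  have h := (convexOn_rpow hr).2 (Set.mem_Ici.2 ha) (Set.mem_Ici.2 hb) (by norm_num : (0:ℝ) ≤ 1 / 2)
    (by norm_num : (0:ℝ) ≤ 1 / 2) (by norm_num)
  simp only [smul_eq_mul] at h
  rw [show (a + b) / 2 = 1 / 2 * a + 1 / 2 * b by ring]
  linarith

theorem le_two_mul_rpow {r a b : ℝ} (hr0 : 0 ≤ r) (hr : r ≤ 1) (ha : 0 ≤ a) (hb : 0 ≤ b) :
    a ^ r + b ^ r ≤ 2 * ((a + b) / 2) ^ r := by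
  have h := (Real.concaveOn_rpow hr0 hr).2 (Set.mem_Ici.2 ha) (Set.mem_Ici.2 hb)
    (by norm_num : (0:ℝ) ≤ 1 / 2) (by norm_num : (0:ℝ) ≤ 1 / 2) (by norm_num)
  simp only [smul_eq_mul] at h
  rw [show (a + b) / 2 = 1 / 2 * a + 1 / 2 * b by ring]
  linarith

theorem norm_sq_columnOp_eq_half (x y : E →L[ℂ] F) (h : E) :
    ‖columnOp x y h‖ ^ 2 = (‖(x + y) h‖ ^ 2 + ‖(x - y) h‖ ^ 2) / 2 := by
  have := parallelogram_law_with_norm ℂ (x h) (y h)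
  rw [norm_sq_columnOp_apply, add_apply, sub_apply]
  nlinarith

theorem two_mul_ofReal (a : ℝ) : 2 * ENNReal.ofReal a = ENNReal.ofReal (2 * a) := by
  rw [ENNReal.ofReal_mul (by norm_num)]
  simp

/-- C†C is the mean of (x ± y)†(x ± y): in an eigenbasis of C†C use convexity of t^(p/2), then
compare the diagonal sums of x ± y with their singular values. -/
theorem two_mul_schattenSum_columnOp_le {p : ℝ} (hp : 2 < p) {x y : E →L[ℂ] F}
    (hx : IsCompactOperator x) (hy : IsCompactOperator y) :
    2 * schattenSum p (columnOp x y) ≤ schattenSum p (x + y) + schattenSum p (x - y) := by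
  have hp0 : 0 < p := by linarith
  obtain ⟨κ, w, hw⟩ := exists_eigenbasis (hx.columnOp hy)
  refine le_trans ?_ (add_le_add (tsum_enorm_rpow_le_schattenSum hp (T := x + y) (hx.add hy) w).1
    (tsum_enorm_rpow_le_schattenSum hp (T := x - y) (hx.sub hy) w).1)
  rw [schattenSum_eq_tsum hp0 (hx.columnOp hy) w fun k => ⟨_, hw k⟩, ← ENNReal.tsum_mul_left,
    ← ENNReal.tsum_add]
  refine ENNReal.tsum_le_tsum fun k => ?_
  simp_rw [enorm_rpow_eq_ofReal _ hp0, norm_sq_columnOp_eq_half]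
  rw [two_mul_ofReal _, ← ENNReal.ofReal_add (by positivity) (by positivity)]
  exact ENNReal.ofReal_le_ofReal (two_mul_rpow_le (by linarith) (by positivity) (by positivity))

theorem le_two_mul_schattenSum_columnOp {p : ℝ} (hp0 : 0 < p) (hp : p < 2) {x y : E →L[ℂ] F}
    (hx : IsCompactOperator x) (hy : IsCompactOperator y) :
    schattenSum p (x + y) + schattenSum p (x - y) ≤ 2 * schattenSum p (columnOp x y) := by
  obtain ⟨κ, w, hw⟩ := exists_eigenbasis (hx.columnOp hy)
  refine (add_le_add (schattenSum_le_tsum_enorm_rpow hp0 hp (T := x + y) (hx.add hy) w).1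
    (schattenSum_le_tsum_enorm_rpow hp0 hp (T := x - y) (hx.sub hy) w).1).trans ?_
  rw [schattenSum_eq_tsum hp0 (hx.columnOp hy) w fun k => ⟨_, hw k⟩, ← ENNReal.tsum_mul_left,
    ← ENNReal.tsum_add]
  refine ENNReal.tsum_le_tsum fun k => ?_
  simp_rw [enorm_rpow_eq_ofReal _ hp0, norm_sq_columnOp_eq_half]
  rw [two_mul_ofReal _, ← ENNReal.ofReal_add (by positivity) (by positivity)]
  exact ENNReal.ofReal_le_ofReal
    (le_two_mul_rpow (by linarith) (by linarith) (by positivity) (by positivity))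

/-- The sum for C lies between the diagonal sum in φ, which is that of x plus that of y, and half of
the sums for x ± y. The hypothesis makes these ends equal, so φ is an eigenbasis of CC† and the
block yx† is zero. -/
theorem comp_adjoint_eq_zero_of_schattenSum_eq {p : ℝ} (hp0 : 0 < p) (hp2 : p ≠ 2)
    {x y : E →L[ℂ] F} (hx : IsCompactOperator x) (hy : IsCompactOperator y)
    (hxf : schattenSum p x ≠ ⊤) (hyf : schattenSum p y ≠ ⊤)
    (h : schattenSum p (x + y) + schattenSum p (x - y) =
      2 * (schattenSum p x + schattenSum p y)) : y ∘L x† = 0 := by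
  obtain ⟨ι, κ, b, φ, hφ, hsum, -⟩ := exists_hilbertBasis_schattenSum_add_eq hp0 hx hy
  have hf : schattenSum p x + schattenSum p y ≠ ⊤ := ENNReal.add_ne_top.2 ⟨hxf, hyf⟩
  have hT := (hx.columnOp hy).adjoint
  suffices hs : schattenSum p ((columnOp x y)†) = schattenSum p x + schattenSum p y by
    refine comp_adjoint_eq_zero_of_columnOp b hφ fun j => ?_
    rcases hp2.lt_or_gt with hp | hp
    · have := (schattenSum_le_tsum_enorm_rpow hp0 hp hT φ).2 (hs.trans hsum) (hs ▸ hf) j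
      rw [adjoint_adjoint] at this
      exact ⟨_, this⟩
    · have := (tsum_enorm_rpow_le_schattenSum hp hT φ).2 (hs.trans hsum).symm (hs ▸ hf) j
      rw [adjoint_adjoint] at this
      exact ⟨_, this⟩
  rcases hp2.lt_or_gt with hp | hp
  · have h1 := (schattenSum_le_tsum_enorm_rpow hp0 hp hT φ).1
    have h2 := le_two_mul_schattenSum_columnOp hp0 hp hx hy
    rw [h, ENNReal.mul_le_mul_iff_right two_ne_zero ENNReal.ofNat_ne_top] at h2
    rw [← hsum] at h1
    rw [schattenSum_adjoint] at h1 ⊢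
    exact le_antisymm h1 h2
  · have h1 := (tsum_enorm_rpow_le_schattenSum hp hT φ).1
    have h2 := two_mul_schattenSum_columnOp_le hp hx hy
    rw [h, ENNReal.mul_le_mul_iff_right two_ne_zero ENNReal.ofNat_ne_top] at h2
    rw [← hsum] at h1
    rw [schattenSum_adjoint] at h1 ⊢
    exact le_antisymm h2 h1

/-- Vanishing of x†y gives (x + y)†(x + y) = C†C, and vanishing of yx† makes φ an eigenbasis of CC†.
-/
theorem schattenSum_add_eq_of_orthogonal {p : ℝ} (hp0 : 0 < p) {x y : E →L[ℂ] F}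
    (hx : IsCompactOperator x) (hy : IsCompactOperator y)
    (h1 : x† ∘L y = 0) (h2 : y ∘L x† = 0) :
    schattenSum p (x + y) = schattenSum p x + schattenSum p y := by
  have h1' : y† ∘L x = 0 := by
    have := congrArg adjoint h1
    simpa [adjoint_comp] using this
  have h2' : x ∘L y† = 0 := by
    have := congrArg adjoint h2
    simpa [adjoint_comp] using this
  obtain ⟨ι, κ, b, φ, hφ, hsum, heig⟩ := exists_hilbertBasis_schattenSum_add_eq hp0 hx hy
  have hT := (hx.columnOp hy).adjoint
  rw [hsum, schattenSum_congr p (T := columnOp x y), ← schattenSum_adjoint,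
    schattenSum_eq_tsum hp0 hT φ]
  · rw [adjoint_adjoint]
    exact heig (fun h => congrArg (fun T : F →L[ℂ] F => T h) h2')
      (fun h => congrArg (fun T : F →L[ℂ] F => T h) h2)
  · rw [adjoint_comp_columnOp, map_add, comp_add, add_comp, add_comp, h1, h1']
    abel

theorem schattenSum_neg (p : ℝ) (x : E →L[ℂ] F) : schattenSum p (-x) = schattenSum p x :=
  schattenSum_congr p (by simp)

/-- McCarthy's characterisation of orthogonality through the equality case of the Clarkson type
inequality for the Schatten classes. -/
theorem schattenSum_parallelogram_iff {p : ℝ} (hp0 : 0 < p) (hp2 : p ≠ 2)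
    {x y : E →L[ℂ] F} (hx : IsCompactOperator x) (hy : IsCompactOperator y)
    (hxf : schattenSum p x ≠ ⊤) (hyf : schattenSum p y ≠ ⊤) :
    schattenSum p (x + y) + schattenSum p (x - y) = 2 * (schattenSum p x + schattenSum p y) ↔
      x† ∘L y = 0 ∧ y ∘L x† = 0 := by
  constructor
  · intro h
    refine ⟨?_, comp_adjoint_eq_zero_of_schattenSum_eq hp0 hp2 hx hy hxf hyf h⟩
    -- The hypothesis is invariant under adjoints, and the one-sided result for x†, y† is the other
    -- half of orthogonality.
    rw [← schattenSum_adjoint p x, ← schattenSum_adjoint p y, ← schattenSum_adjoint p (x + y),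
      ← schattenSum_adjoint p (x - y), map_add, map_sub] at h
    have h1 := comp_adjoint_eq_zero_of_schattenSum_eq hp0 hp2 hx.adjoint hy.adjoint
      (by rwa [schattenSum_adjoint]) (by rwa [schattenSum_adjoint]) h
    have := congrArg adjoint h1
    simpa [adjoint_comp] using this
  · rintro ⟨h1, h2⟩
    rw [schattenSum_add_eq_of_orthogonal hp0 hx hy h1 h2, sub_eq_add_neg,
      schattenSum_add_eq_of_orthogonal hp0 (y := -y) hx hy.neg (by simp [h1]) (by simp [h2]),
      schattenSum_neg, two_mul]

end Column

/-! ### Bilinear diagonal sums along Bessel families, and strict convexity. -/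

section Bessel

variable {E F : Type*} [NormedAddCommGroup E] [InnerProductSpace ℂ E] [CompleteSpace E]
  [NormedAddCommGroup F] [InnerProductSpace ℂ F] [CompleteSpace F] {ι κ : Type*}

open ContinuousLinearMap

/-- A family of vectors satisfying Bessel's inequality. -/
def IsBessel (v : ι → F) : Prop :=
  ∀ h : F, Summable (fun i => ‖⟪v i, h⟫_ℂ‖ ^ 2) ∧ ∑' i, ‖⟪v i, h⟫_ℂ‖ ^ 2 ≤ ‖h‖ ^ 2

theorem IsBessel.norm_le_one {v : ι → F} (hv : IsBessel v) (i : ι) : ‖v i‖ ≤ 1 := by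
  have h1 := (hv (v i)).1.le_tsum i fun _ _ => by positivity
  have h2 := h1.trans (hv (v i)).2
  rw [inner_self_eq_norm_sq_to_K, norm_pow, RCLike.norm_ofReal, abs_norm] at h2
  by_contra h
  rw [not_le] at h
  nlinarith [mul_pos (mul_pos (zero_lt_one.trans h) (zero_lt_one.trans h)) (sub_pos.2 h)]

theorem IsBessel.tsum_le_one {v : ι → F} (hv : IsBessel v) {h : F} (hh : ‖h‖ ≤ 1) :
    ∑' i, ‖⟪v i, h⟫_ℂ‖ ^ 2 ≤ 1 :=
  (hv h).2.trans (pow_le_one₀ (norm_nonneg _) hh)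

theorem IsBessel.tsum_ofReal_le_one {v : ι → F} (hv : IsBessel v) {h : F} (hh : ‖h‖ ≤ 1) :
    ∑' i, ENNReal.ofReal (‖⟪h, v i⟫_ℂ‖ ^ 2) ≤ 1 := by
  simp_rw [norm_inner_symm h]
  rw [← ENNReal.ofReal_tsum_of_nonneg (fun i => by positivity) (hv h).1]
  exact ENNReal.ofReal_le_one.2 (hv.tsum_le_one hh)

theorem HilbertBasis.isBessel (b : HilbertBasis ι ℂ E) : IsBessel b := fun h =>
  ⟨(b.hasSum_sq_norm_inner h).summable, (b.hasSum_sq_norm_inner h).tsum_eq.le⟩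

/-- The left singular vectors attached to a family of right singular vectors, extended by zero. -/
def leftSingular (x : E →L[ℂ] F) (e : κ → E) (k : κ) : F := ((‖x (e k)‖⁻¹ : ℝ) : ℂ) • x (e k)

theorem norm_smul_leftSingular (x : E →L[ℂ] F) (e : κ → E) (k : κ) :
    ((‖x (e k)‖ : ℝ) : ℂ) • leftSingular x e k = x (e k) := by
  by_cases h : x (e k) = 0
  · simp [leftSingular, h]
  · rw [leftSingular, smul_smul, ← Complex.ofReal_mul, mul_inv_cancel₀ (norm_ne_zero_iff.2 h)]
    simp

theorem inner_leftSingular (x : E →L[ℂ] F) (e : κ → E) (k : κ) :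
    ⟪leftSingular x e k, x (e k)⟫_ℂ = (‖x (e k)‖ : ℂ) := by
  by_cases h : x (e k) = 0
  · simp [leftSingular, h]
  · have : (‖x (e k)‖ : ℂ) ≠ 0 := by exact_mod_cast norm_ne_zero_iff.2 h
    rw [leftSingular, inner_smul_left, Complex.conj_ofReal, inner_self_eq_norm_sq_to_K]
    push_cast
    field_simp
    simp

theorem orthonormal_leftSingular {x : E →L[ℂ] F} (e : HilbertBasis κ ℂ E)
    (he : ∀ k, (x†) (x (e k)) = ((‖x (e k)‖ ^ 2 : ℝ) : ℂ) • e k) :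
    Orthonormal ℂ fun k : {k // x (e k) ≠ 0} => leftSingular x e k := by
  constructor
  · rintro ⟨k, hk⟩
    change ‖((‖x (e k)‖⁻¹ : ℝ) : ℂ) • x (e k)‖ = 1
    rw [norm_smul, Complex.norm_real, norm_inv, norm_norm,
      inv_mul_cancel₀ (norm_ne_zero_iff.2 hk)]
  · rintro ⟨k, hk⟩ ⟨l, hl⟩ hkl
    have h : ⟪x (e k), x (e l)⟫_ℂ = 0 := by
      rw [← adjoint_inner_left, he, inner_smul_left,
        e.orthonormal.2 (fun h => hkl (Subtype.ext h)), mul_zero]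
    simp [leftSingular, inner_smul_left, inner_smul_right, h]

theorem isBessel_leftSingular {x : E →L[ℂ] F} (e : HilbertBasis κ ℂ E)
    (he : ∀ k, (x†) (x (e k)) = ((‖x (e k)‖ ^ 2 : ℝ) : ℂ) • e k) :
    IsBessel (leftSingular x e) := by
  intro h
  have hon := orthonormal_leftSingular e he
  have h0 : ∀ k, k ∉ Set.range (Subtype.val : {k // x (e k) ≠ 0} → κ) →
      ‖⟪leftSingular x e k, h⟫_ℂ‖ ^ 2 = 0 := fun k hk => by
    have : x (e k) = 0 := by
      by_contra hne
      exact hk ⟨⟨k, hne⟩, rfl⟩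
    simp [leftSingular, this]
  refine ⟨(Subtype.val_injective.summable_iff h0).1 (hon.inner_products_summable (x := h)), ?_⟩
  rw [← Subtype.val_injective.tsum_eq (fun k hk => by
    by_contra hne
    exact hk (h0 k hne))]
  exact hon.tsum_inner_products_le (x := h)

/-- Expand ⟨v, xu⟩ along the singular value decomposition and apply 2ab ≤ a² + b² termwise. -/
theorem norm_inner_apply_le {x : E →L[ℂ] F} (e : HilbertBasis κ ℂ E)
    (he : ∀ k, (x†) (x (e k)) = ((‖x (e k)‖ ^ 2 : ℝ) : ℂ) • e k) (u : E) (v : F) :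
    ‖⟪v, x u⟫_ℂ‖ ≤ (∑' k, ‖⟪e k, u⟫_ℂ‖ ^ 2 * ‖x (e k)‖ +
      ∑' k, ‖⟪leftSingular x e k, v⟫_ℂ‖ ^ 2 * ‖x (e k)‖) / 2 := by
  have hle : ∀ k, ‖x (e k)‖ ≤ ‖x‖ := fun k => by
    simpa [e.orthonormal.1 k] using x.le_opNorm (e k)
  have h1 : HasSum (fun k => ⟪e k, u⟫_ℂ * ⟪v, x (e k)⟫_ℂ) ⟪v, x u⟫_ℂ := by
    have := ((innerSL ℂ v) ∘L x).hasSum (e.hasSum_repr u)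
    simpa [inner_smul_right, e.repr_apply_apply] using this
  have hA := (summable_mul_of_le_const (fun k => by positivity) (e.isBessel u).1
    (fun k => norm_nonneg (x (e k))) hle).hasSum
  have hB := (summable_mul_of_le_const (fun k => by positivity) (isBessel_leftSingular e he v).1
    (fun k => norm_nonneg (x (e k))) hle).hasSum
  rw [← h1.tsum_eq]
  refine tsum_of_norm_bounded ((hA.add hB).div_const 2) fun k => ?_
  have h2 : ‖⟪v, x (e k)⟫_ℂ‖ = ‖x (e k)‖ * ‖⟪leftSingular x e k, v⟫_ℂ‖ := by
    rw [← norm_smul_leftSingular x e k, inner_smul_right, norm_mul,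
      norm_inner_symm v, norm_smul_leftSingular x e k]
    simp
  rw [norm_mul, h2]
  nlinarith [mul_nonneg (norm_nonneg (x (e k)))
    (sq_nonneg (‖⟪e k, u⟫_ℂ‖ - ‖⟪leftSingular x e k, v⟫_ℂ‖))]

theorem eq_of_two_mul_rpow_eq {p A B d : ℝ} (hp : 1 < p) (hA : 0 ≤ A) (hB : 0 ≤ B) (hd : 0 ≤ d)
    (h : d ≤ (A + B) / 2) (he : 2 * d ^ p = A ^ p + B ^ p) : A = B ∧ d = A := by
  have h1 : d ^ p ≤ ((A + B) / 2) ^ p := Real.rpow_le_rpow hd h (by linarith)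
  have hAB : A = B := by
    by_contra hne
    have := (strictConvexOn_rpow hp).2 (Set.mem_Ici.2 hA) (Set.mem_Ici.2 hB) hne
      (by norm_num : (0:ℝ) < 1 / 2) (by norm_num : (0:ℝ) < 1 / 2) (by norm_num)
    simp only [smul_eq_mul] at this
    rw [show 1 / 2 * A + 1 / 2 * B = (A + B) / 2 by ring] at this
    linarith
  refine ⟨hAB, ?_⟩
  subst hAB
  have h2 : d ^ p = A ^ p := by linarith
  exact (Real.rpow_left_inj hd hA (by linarith)).1 h2

theorem enorm_rpow_eq_ofReal_rpow {G : Type*} [NormedAddCommGroup G] (x : G) {p : ℝ} (hp : 0 ≤ p) :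
    ‖x‖ₑ ^ p = ENNReal.ofReal (‖x‖ ^ p) := by
  rw [← ofReal_norm, ENNReal.ofReal_rpow_of_nonneg (norm_nonneg x) hp]

theorem ENNReal.eq_and_eq_of_add_eq_two_mul {a b c : ENNReal} (hc : c ≠ ⊤) (ha : a ≤ c)
    (hb : b ≤ c) (h : 2 * c ≤ a + b) : a = c ∧ b = c := by
  lift c to NNReal using hc
  lift a to NNReal using (ha.trans_lt ENNReal.coe_lt_top).ne
  lift b to NNReal using (hb.trans_lt ENNReal.coe_lt_top).ne
  norm_cast at *
  have ha' : (a : ℝ) ≤ c := ha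
  have hb' : (b : ℝ) ≤ c := hb
  have h' : (2 : ℝ) * c ≤ a + b := h
  exact ⟨NNReal.eq (by linarith), NNReal.eq (by linarith)⟩

theorem apply_eq_smul_of_norm_le {x v : F} (hv : ‖v‖ ≤ 1) (h : ‖x‖ ≤ ‖⟪v, x⟫_ℂ‖) :
    x = ⟪v, x⟫_ℂ • v := by
  have h1 : ‖x - ⟪v, x⟫_ℂ • v‖ ^ 2 = ‖x‖ ^ 2 - 2 * ‖⟪v, x⟫_ℂ‖ ^ 2 +
      ‖⟪v, x⟫_ℂ‖ ^ 2 * ‖v‖ ^ 2 := by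
    rw [@norm_sub_sq ℂ, inner_smul_right, ← inner_conj_symm x v, RCLike.mul_conj, norm_smul,
      mul_pow]
    norm_cast
  have h2 : ‖x - ⟪v, x⟫_ℂ • v‖ ^ 2 ≤ 0 := by
    have h3 : ‖x‖ ^ 2 ≤ ‖⟪v, x⟫_ℂ‖ ^ 2 := pow_le_pow_left₀ (norm_nonneg _) h 2
    have h4 : ‖v‖ ^ 2 ≤ 1 := pow_le_one₀ (norm_nonneg _) hv
    nlinarith [sq_nonneg ‖⟪v, x⟫_ℂ‖]
  have h3 : ‖x - ⟪v, x⟫_ℂ • v‖ = 0 := by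
    have := sq_nonneg ‖x - ⟪v, x⟫_ℂ • v‖
    exact pow_eq_zero_iff two_ne_zero |>.1 (le_antisymm h2 this)
  exact sub_eq_zero.1 (norm_eq_zero.1 h3)

/-- Both averages A, B of singular values come from substochastic weights, so Jensen with exponent p
applies to each. Bessel families are allowed because left singular vectors extended by zero are not
a basis. -/
theorem tsum_enorm_inner_rpow_le_schattenSum {p : ℝ} (hp : 1 < p) {x : E →L[ℂ] F}
    (hx : IsCompactOperator x) {u : ι → E} {v : ι → F} (hu : IsBessel u) (hv : IsBessel v) :
    ∑' i, ‖⟪v i, x (u i)⟫_ℂ‖ₑ ^ p ≤ schattenSum p x ∧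
      (∑' i, ‖⟪v i, x (u i)⟫_ℂ‖ₑ ^ p = schattenSum p x → schattenSum p x ≠ ⊤ →
        ∀ i, x (u i) = ⟪v i, x (u i)⟫_ℂ • v i) := by
  obtain ⟨κ, e, he⟩ := exists_eigenbasis hx
  have hp0 : 0 < p := by linarith
  have hf := isBessel_leftSingular e he
  have hle : ∀ k, ‖x (e k)‖ ≤ ‖x‖ := fun k => by
    simpa [e.orthonormal.1 k] using x.le_opNorm (e k)
  have kA := tsum_rpow_tsum_mul_le (A := fun i k => ‖⟪e k, u i⟫_ℂ‖ ^ 2)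
    (t := fun k => ‖x (e k)‖) hp (fun i k => by positivity) (fun i => (e.isBessel (u i)).1)
    (fun i => e.isBessel.tsum_le_one (hu.norm_le_one i))
    (fun k => hu.tsum_ofReal_le_one (e.orthonormal.1 k).le) (fun k => norm_nonneg _) hle
  have kB := (tsum_rpow_tsum_mul_le (A := fun i k => ‖⟪leftSingular x e k, v i⟫_ℂ‖ ^ 2)
    (t := fun k => ‖x (e k)‖) hp (fun i k => by positivity) (fun i => (hf (v i)).1)
    (fun i => hf.tsum_le_one (hv.norm_le_one i))
    (fun k => hv.tsum_ofReal_le_one (hf.norm_le_one k)) (fun k => norm_nonneg _) hle).1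
  simp_rw [← enorm_rpow_eq_ofReal_rpow (x (e _)) hp0.le] at kA kB
  rw [← schattenSum_eq_tsum hp0 hx e fun k => ⟨_, he k⟩] at kA kB
  set A : ι → ℝ := fun i => ∑' k, ‖⟪e k, u i⟫_ℂ‖ ^ 2 * ‖x (e k)‖ with hA
  set B : ι → ℝ := fun i => ∑' k, ‖⟪leftSingular x e k, v i⟫_ℂ‖ ^ 2 * ‖x (e k)‖ with hB
  have hA0 : ∀ i, 0 ≤ A i := fun i => tsum_nonneg fun k => by positivity
  have hB0 : ∀ i, 0 ≤ B i := fun i => tsum_nonneg fun k => by positivity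
  have hd : ∀ i, ‖⟪v i, x (u i)⟫_ℂ‖ ≤ (A i + B i) / 2 := fun i => norm_inner_apply_le e he _ _
  have hpt : ∀ i, 2 * ‖⟪v i, x (u i)⟫_ℂ‖ₑ ^ p ≤
      ENNReal.ofReal (A i ^ p) + ENNReal.ofReal (B i ^ p) := fun i => by
    rw [enorm_rpow_eq_ofReal_rpow _ hp0.le, two_mul_ofReal, ← ENNReal.ofReal_add
      (Real.rpow_nonneg (hA0 i) p) (Real.rpow_nonneg (hB0 i) p)]
    apply ENNReal.ofReal_le_ofReal
    refine le_trans ?_ (two_mul_rpow_le hp.le (hA0 i) (hB0 i))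
    gcongr
    exact hd i
  have hs : 2 * ∑' i, ‖⟪v i, x (u i)⟫_ℂ‖ₑ ^ p ≤
      ∑' i, ENNReal.ofReal (A i ^ p) + ∑' i, ENNReal.ofReal (B i ^ p) := by
    rw [← ENNReal.tsum_mul_left, ← ENNReal.tsum_add]
    exact ENNReal.tsum_le_tsum hpt
  refine ⟨?_, fun h1 h2 i => ?_⟩
  · have := hs.trans (add_le_add kA.1 kB)
    rwa [← two_mul, ENNReal.mul_le_mul_iff_right two_ne_zero ENNReal.ofNat_ne_top] at this
  · rw [h1] at hs
    obtain ⟨hAe, hBe⟩ := ENNReal.eq_and_eq_of_add_eq_two_mul h2 kA.1 kB hs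
    have h3 : 2 * ‖⟪v i, x (u i)⟫_ℂ‖ₑ ^ p =
        ENNReal.ofReal (A i ^ p) + ENNReal.ofReal (B i ^ p) := by
      refine ENNReal.eq_of_tsum_eq_of_le hpt ?_ ?_ i
      · rw [ENNReal.tsum_mul_left, ENNReal.tsum_add, hAe, hBe, h1, two_mul]
      · rw [ENNReal.tsum_mul_left, h1]
        exact ENNReal.mul_ne_top ENNReal.ofNat_ne_top h2
    rw [enorm_rpow_eq_ofReal_rpow _ hp0.le, two_mul_ofReal, ← ENNReal.ofReal_add
      (Real.rpow_nonneg (hA0 i) p) (Real.rpow_nonneg (hB0 i) p),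
      ENNReal.ofReal_eq_ofReal_iff (by positivity)
      (add_nonneg (Real.rpow_nonneg (hA0 i) p) (Real.rpow_nonneg (hB0 i) p))] at h3
    -- Equality gives |⟨v_i, x u_i⟩| = A_i and x†x u_i = A_i² u_i, hence ‖x u_i‖ ≤ |⟨v_i, x u_i⟩|:
    -- the equality case of Cauchy–Schwarz.
    have h4 := (eq_of_two_mul_rpow_eq hp (hA0 i) (hB0 i) (norm_nonneg _) (hd i) h3).2
    have h5 : (x†) (x (u i)) = ((A i ^ 2 : ℝ) : ℂ) • u i :=
      adjoint_apply_apply_of_inner_ne_zero e he fun k hk => by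
        rw [kA.2 hAe h2 i k (by simpa using hk)]
    refine apply_eq_smul_of_norm_le (hv.norm_le_one i) ?_
    have h6 : ‖x (u i)‖ ^ 2 = A i ^ 2 * ‖u i‖ ^ 2 := by
      have := congrArg (fun z => ⟪u i, z⟫_ℂ) h5
      simp only [adjoint_inner_right, inner_self_eq_norm_sq_to_K, inner_smul_right] at this
      apply Complex.ofReal_injective
      push_cast at this ⊢
      exact this
    rw [h4]
    refine le_of_sq_le_sq ?_ (hA0 i)
    rw [h6]
    exact mul_le_of_le_one_right (sq_nonneg _) (pow_le_one₀ (norm_nonneg _) (hu.norm_le_one i))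

/-- Strict convexity of the unit sphere, for antipodal points. -/
theorem eq_neg_of_schattenSum_sub_eq {p : ℝ} (hp : 1 < p) {x y : E →L[ℂ] F}
    (hx : IsCompactOperator x) (hy : IsCompactOperator y)
    (hx1 : schattenSum p x = 1) (hy1 : schattenSum p y = 1)
    (h : schattenSum p (x - y) = 2 ^ p) : y = -x := by
  have hp0 : 0 < p := by linarith
  have hz : IsCompactOperator (x - y : E →L[ℂ] F) := hx.sub hy
  obtain ⟨κ, e, he⟩ := exists_eigenbasis hz
  -- Test x and y against the singular vectors of x - y; there the diagonal entries satisfy a_k -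
  -- b_k = ‖(x - y)e_k‖.
  set f := leftSingular (x - y) e with hf
  have kx := tsum_enorm_inner_rpow_le_schattenSum hp hx e.isBessel (isBessel_leftSingular e he)
  have ky := tsum_enorm_inner_rpow_le_schattenSum hp hy e.isBessel (isBessel_leftSingular e he)
  rw [← hf, hx1] at kx
  rw [← hf, hy1] at ky
  set a : κ → ℂ := fun k => ⟪f k, x (e k)⟫_ℂ with ha
  set b : κ → ℂ := fun k => ⟪f k, y (e k)⟫_ℂ with hb
  have hab : ∀ k, ‖(x - y) (e k)‖ = ‖a k - b k‖ := fun k => by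
    have := inner_leftSingular (x - y) e k
    rw [sub_apply, inner_sub_right] at this
    simp only [ha, hb, hf]
    rw [this]
    simp
  have hd : ∀ k, ‖(x - y) (e k)‖ / 2 ≤ (‖a k‖ + ‖b k‖) / 2 := fun k => by
    rw [hab]
    gcongr
    exact norm_sub_le _ _
  have hpt : ∀ k, 2 * ENNReal.ofReal ((‖(x - y) (e k)‖ / 2) ^ p) ≤ ‖a k‖ₑ ^ p + ‖b k‖ₑ ^ p := by
    intro k
    rw [enorm_rpow_eq_ofReal_rpow _ hp0.le, enorm_rpow_eq_ofReal_rpow _ hp0.le, two_mul_ofReal,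
      ← ENNReal.ofReal_add (by positivity) (by positivity)]
    apply ENNReal.ofReal_le_ofReal
    refine le_trans ?_ (two_mul_rpow_le hp.le (norm_nonneg _) (norm_nonneg _))
    exact mul_le_mul_of_nonneg_left (Real.rpow_le_rpow (by positivity) (hd k) hp0.le) (by norm_num)
  have hsum : ∑' k, ENNReal.ofReal ((‖(x - y) (e k)‖ / 2) ^ p) = 1 := by
    have h1 : ∀ k, ENNReal.ofReal ((‖(x - y) (e k)‖ / 2) ^ p) =
        ‖(x - y) (e k)‖ₑ ^ p / 2 ^ p := fun k => by
      rw [enorm_rpow_eq_ofReal_rpow _ hp0.le, Real.div_rpow (norm_nonneg _) (by norm_num),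
        ENNReal.ofReal_div_of_pos (by positivity), ← ENNReal.ofReal_rpow_of_pos (x := 2) (by norm_num)]
      simp
    simp_rw [h1, ENNReal.div_eq_inv_mul]
    rw [ENNReal.tsum_mul_left, ← schattenSum_eq_tsum hp0 hz e fun k => ⟨_, he k⟩, h]
    exact ENNReal.inv_mul_cancel (by simp [ENNReal.rpow_eq_zero_iff])
      (ENNReal.rpow_ne_top_of_nonneg hp0.le (by simp))
  have hs : 2 * 1 ≤ ∑' k, ‖a k‖ₑ ^ p + ∑' k, ‖b k‖ₑ ^ p := by
    rw [← ENNReal.tsum_add, ← hsum, ← ENNReal.tsum_mul_left]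
    exact ENNReal.tsum_le_tsum hpt
  obtain ⟨hA, hB⟩ := ENNReal.eq_and_eq_of_add_eq_two_mul ENNReal.one_ne_top kx.1 ky.1 hs
  have hneg : ∀ k, y (e k) = (-x) (e k) := fun k => by
    have h3 : 2 * ENNReal.ofReal ((‖(x - y) (e k)‖ / 2) ^ p) = ‖a k‖ₑ ^ p + ‖b k‖ₑ ^ p := by
      refine ENNReal.eq_of_tsum_eq_of_le hpt ?_ ?_ k
      · rw [ENNReal.tsum_mul_left, ENNReal.tsum_add, hA, hB, hsum]
        norm_num
      · rw [ENNReal.tsum_mul_left, hsum]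
        simp
    rw [enorm_rpow_eq_ofReal_rpow _ hp0.le, enorm_rpow_eq_ofReal_rpow _ hp0.le, two_mul_ofReal,
      ← ENNReal.ofReal_add (by positivity) (by positivity),
      ENNReal.ofReal_eq_ofReal_iff (by positivity) (by positivity)] at h3
    obtain ⟨h4, h5⟩ := eq_of_two_mul_rpow_eq hp (norm_nonneg _) (norm_nonneg _) (by positivity)
      (hd k) h3
    -- Now |a_k| = |b_k| = |a_k - b_k|/2, and the parallelogram law leaves nothing for a_k + b_k.
    have h6 : a k + b k = 0 := by
      have := parallelogram_law_with_norm ℂ (a k) (b k)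
      rw [← hab] at this
      have h8 : ‖(x - y) (e k)‖ = 2 * ‖a k‖ := by linarith
      rw [h8, ← h4] at this
      have h7 : ‖a k + b k‖ ^ 2 = 0 := by linarith
      simpa using h7
    rw [ky.2 hB ENNReal.one_ne_top k, neg_apply, kx.2 hA ENNReal.one_ne_top k, ← neg_smul]
    congr 1
    exact (neg_eq_of_add_eq_zero_right h6).symm
  ext z
  have h1 := y.hasSum (e.hasSum_repr z)
  have h2 := (-x).hasSum (e.hasSum_repr z)
  refine h1.unique ?_
  convert! h2 using 1
  ext k
  rw [map_smul, map_smul, hneg]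

end Bessel

/-! ### Recovering the sum and product of two numbers from power sums. -/

section PowerSums

variable {r X Y X' Y' : ℝ}

theorem exists_add_eq_mul_eq {S D : ℝ} (hS : 0 ≤ S) (hD : 0 ≤ D) (h : 4 * D ≤ S ^ 2) :
    ∃ X Y : ℝ, 0 ≤ X ∧ 0 ≤ Y ∧ X + Y = S ∧ X * Y = D := by
  have hs := Real.sq_sqrt (sub_nonneg.2 h)
  have hle : Real.sqrt (S ^ 2 - 4 * D) ≤ S := Real.sqrt_le_iff.2 ⟨hS, by linarith⟩
  refine ⟨(S + Real.sqrt (S ^ 2 - 4 * D)) / 2, (S - Real.sqrt (S ^ 2 - 4 * D)) / 2,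
    by positivity, by linarith, by ring, by nlinarith⟩

/-- With the larger entries named X and X', one gets X < X'. The quadratic with roots X^r, Y^r is
then positive at X'^r, and the products of the r-th powers agree. -/
theorem rpow_add_rpow_lt_of_mul_eq (hr : 0 < r) (hX : 0 ≤ X) (hY : 0 ≤ Y) (hX' : 0 ≤ X')
    (hY' : 0 ≤ Y') (hm : X * Y = X' * Y') (hs : X + Y < X' + Y') :
    X ^ r + Y ^ r < X' ^ r + Y' ^ r := by
  wlog h : Y ≤ X generalizing X Y
  · have := this hY hX (by linarith) (by linarith) (by linarith)
    linarith
  wlog h' : Y' ≤ X' generalizing X' Y'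
  · have := this hY' hX' (by linarith) (by linarith) (by linarith)
    linarith
  have hlt : X < X' := by
    by_contra hle
    rw [not_lt] at hle
    rcases hX.eq_or_lt with h0 | h0
    · linarith
    · have : 0 ≤ (X - X') * (X - Y') := mul_nonneg (by linarith) (by linarith)
      nlinarith
  have h1 : X ^ r < X' ^ r := Real.rpow_lt_rpow hX hlt hr
  have h2 : Y ^ r ≤ X ^ r := Real.rpow_le_rpow hY h hr.le
  have h3 : X ^ r * Y ^ r = X' ^ r * Y' ^ r := by
    rw [← Real.mul_rpow hX hY, hm, Real.mul_rpow hX' hY']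
  have h4 : 0 ≤ X ^ r := Real.rpow_nonneg hX r
  have h5 : 0 < (X' ^ r - X ^ r) * (X' ^ r - Y ^ r) := mul_pos (by linarith) (by linarith)
  by_contra hle
  rw [not_lt] at hle
  nlinarith

theorem rpow_add_rpow_le_of_mul_eq (hr : 0 < r) (hX : 0 ≤ X) (hY : 0 ≤ Y) (hX' : 0 ≤ X')
    (hY' : 0 ≤ Y') (hm : X * Y = X' * Y') (hs : X + Y ≤ X' + Y') :
    X ^ r + Y ^ r ≤ X' ^ r + Y' ^ r := by
  rcases hs.lt_or_eq with hs | hs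
  · exact (rpow_add_rpow_lt_of_mul_eq hr hX hY hX' hY' hm hs).le
  · have h : (X - X') * (X - Y') = 0 := by
      have : Y = X' + Y' - X := by linarith
      subst this
      linarith
    rcases mul_eq_zero.1 h with h | h
    · obtain rfl : X = X' := by linarith
      obtain rfl : Y = Y' := by linarith
      exact le_rfl
    · obtain rfl : X = Y' := by linarith
      obtain rfl : Y = X' := by linarith
      exact (add_comm _ _).le

/-- At equal sums a larger product means a smaller gap, so X' and Y' lie strictly between Y and X.
-/
theorem exists_convex_combination (hs : X + Y = X' + Y') (hm : X * Y < X' * Y') (h : Y ≤ X)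
    (h' : Y' ≤ X') : ∃ a b : ℝ, 0 < a ∧ 0 < b ∧ a + b = 1 ∧ X ≠ Y ∧
      X' = a * X + b * Y ∧ Y' = b * X + a * Y := by
  have h1 : X' - Y' < X - Y := by
    refine lt_of_pow_lt_pow_left₀ 2 (by linarith) ?_
    have h3 : (X + Y) ^ 2 = (X' + Y') ^ 2 := by rw [hs]
    nlinarith
  have hXY : 0 < X - Y := by linarith
  refine ⟨(X' - Y) / (X - Y), (X - X') / (X - Y), div_pos (by linarith) hXY,
    div_pos (by linarith) hXY, ?_, by linarith, ?_, ?_⟩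
  · rw [← add_div, div_eq_one_iff_eq hXY.ne']
    ring
  · field_simp
    ring
  · have : Y' = X + Y - X' := by linarith
    rw [this]
    field_simp
    ring

theorem rpow_add_rpow_lt_of_add_eq_of_one_lt (hr : 1 < r) (hX : 0 ≤ X) (hY : 0 ≤ Y)
    (hs : X + Y = X' + Y') (hm : X * Y < X' * Y') : X' ^ r + Y' ^ r < X ^ r + Y ^ r := by
  wlog h : Y ≤ X generalizing X Y
  · have := this hY hX (by linarith) (by linarith) (by linarith)
    linarith
  wlog h' : Y' ≤ X' generalizing X' Y'
  · have := this (X' := Y') (Y' := X') (by linarith) (by linarith) (by linarith)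
    linarith
  obtain ⟨a, b, ha, hb, hab, hne, rfl, rfl⟩ := exists_convex_combination hs hm h h'
  have h1 := (strictConvexOn_rpow hr).2 (Set.mem_Ici.2 hX) (Set.mem_Ici.2 hY) hne ha hb hab
  have h2 := (strictConvexOn_rpow hr).2 (Set.mem_Ici.2 hX) (Set.mem_Ici.2 hY) hne hb ha
    (by linarith)
  simp only [smul_eq_mul] at h1 h2
  have h3 : a * X ^ r + b * Y ^ r + (b * X ^ r + a * Y ^ r) = X ^ r + Y ^ r := by
    linear_combination (X ^ r + Y ^ r) * hab
  linarith

theorem rpow_add_rpow_lt_of_add_eq_of_lt_one (hr0 : 0 < r) (hr : r < 1) (hX : 0 ≤ X) (hY : 0 ≤ Y)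
    (hs : X + Y = X' + Y') (hm : X * Y < X' * Y') : X ^ r + Y ^ r < X' ^ r + Y' ^ r := by
  wlog h : Y ≤ X generalizing X Y
  · have := this hY hX (by linarith) (by linarith) (by linarith)
    linarith
  wlog h' : Y' ≤ X' generalizing X' Y'
  · have := this (X' := Y') (Y' := X') (by linarith) (by linarith) (by linarith)
    linarith
  obtain ⟨a, b, ha, hb, hab, hne, rfl, rfl⟩ := exists_convex_combination hs hm h h'
  have hc := Real.strictConcaveOn_rpow hr0 hr
  have h1 := hc.2 (Set.mem_Ici.2 hX) (Set.mem_Ici.2 hY) hne ha hb hab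
  have h2 := hc.2 (Set.mem_Ici.2 hX) (Set.mem_Ici.2 hY) hne hb ha (by linarith)
  simp only [smul_eq_mul] at h1 h2
  have h3 : a * X ^ r + b * Y ^ r + (b * X ^ r + a * Y ^ r) = X ^ r + Y ^ r := by
    linear_combination (X ^ r + Y ^ r) * hab
  linarith

theorem add_lt_add_of_rpow_eq_of_lt_one (hr0 : 0 < r) (hr : r < 1) (hX : 0 ≤ X) (hY : 0 ≤ Y)
    (hX' : 0 ≤ X') (hY' : 0 ≤ Y') (hm : X * Y < X' * Y')
    (h : X ^ r + Y ^ r = X' ^ r + Y' ^ r) : X' + Y' < X + Y := by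
  by_contra hle
  rw [not_lt] at hle
  -- An intermediate pair with the sum of one pair and the product of the other splits the
  -- comparison into a fixed-product and a fixed-sum step.
  obtain ⟨A, B, hA, hB, hAB, hABm⟩ := exists_add_eq_mul_eq (S := X' + Y') (D := X * Y)
    (by positivity) (by positivity) (by nlinarith [sq_nonneg (X' - Y')])
  have h1 := rpow_add_rpow_le_of_mul_eq hr0 hX hY hA hB hABm.symm (by linarith)
  have h2 := rpow_add_rpow_lt_of_add_eq_of_lt_one hr0 hr hA hB hAB (by linarith)
  linarith

theorem add_lt_add_of_rpow_eq_of_one_lt (hr : 1 < r) (hX : 0 ≤ X) (hY : 0 ≤ Y)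
    (hX' : 0 ≤ X') (hY' : 0 ≤ Y') (hm : X * Y < X' * Y')
    (h : X ^ r + Y ^ r = X' ^ r + Y' ^ r) : X + Y < X' + Y' := by
  by_contra hle
  rw [not_lt] at hle
  obtain ⟨A, B, hA, hB, hAB, hABm⟩ := exists_add_eq_mul_eq (S := X' + Y') (D := X * Y)
    (by positivity) (by positivity) (by nlinarith [sq_nonneg (X' - Y')])
  have h1 := rpow_add_rpow_le_of_mul_eq (zero_lt_one.trans hr) hA hB hX hY hABm (by linarith)
  have h2 := rpow_add_rpow_lt_of_add_eq_of_one_lt hr hA hB hAB (by linarith)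
  linarith

/-- `F` is the sum of the `r`-th powers of the roots of `z ^ 2 - S * z + D`. -/
def IsPowerSum (r S D F : ℝ) : Prop :=
  ∃ X Y : ℝ, 0 ≤ X ∧ 0 ≤ Y ∧ X + Y = S ∧ X * Y = D ∧ X ^ r + Y ^ r = F

/-- At a fixed power sum, raising the product moves the sum in one direction depending only on
whether r < 1. Both sums would move the same way, yet (2 - 2t) + (2 + 2t) = 4 always. -/
theorem IsPowerSum.not_product_lt {r t D t' D' F G : ℝ} (hr0 : 0 < r) (hr1 : r ≠ 1)
    (h1 : IsPowerSum r (2 - 2 * t) D F) (h2 : IsPowerSum r (2 + 2 * t) D G)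
    (h1' : IsPowerSum r (2 - 2 * t') D' F) (h2' : IsPowerSum r (2 + 2 * t') D' G) :
    ¬ D < D' := by
  intro hD
  obtain ⟨X, Y, hX, hY, hs, hm, hF⟩ := h1
  obtain ⟨Z, W, hZ, hW, hs2, hm2, hG⟩ := h2
  obtain ⟨X', Y', hX', hY', hs', hm', hF'⟩ := h1'
  obtain ⟨Z', W', hZ', hW', hs2', hm2', hG'⟩ := h2'
  rcases hr1.lt_or_gt with hr | hr
  · have := add_lt_add_of_rpow_eq_of_lt_one hr0 hr hX hY hX' hY' (by linarith) (by linarith)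
    have := add_lt_add_of_rpow_eq_of_lt_one hr0 hr hZ hW hZ' hW' (by linarith) (by linarith)
    linarith
  · have := add_lt_add_of_rpow_eq_of_one_lt hr hX hY hX' hY' (by linarith) (by linarith)
    have := add_lt_add_of_rpow_eq_of_one_lt hr hZ hW hZ' hW' (by linarith) (by linarith)
    linarith

theorem IsPowerSum.not_lt_left {r S S' D F : ℝ} (hr0 : 0 < r) (h1 : IsPowerSum r S D F)
    (h2 : IsPowerSum r S' D F) : ¬ S < S' := by
  intro hS
  obtain ⟨X, Y, hX, hY, hs, hm, hF⟩ := h1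
  obtain ⟨X', Y', hX', hY', hs', hm', hF'⟩ := h2
  have := rpow_add_rpow_lt_of_mul_eq hr0 hX hY hX' hY' (by linarith) (by linarith)
  linarith

theorem IsPowerSum.eq_and_eq {r t D t' D' F G : ℝ} (hr0 : 0 < r) (hr1 : r ≠ 1)
    (h1 : IsPowerSum r (2 - 2 * t) D F) (h2 : IsPowerSum r (2 + 2 * t) D G)
    (h1' : IsPowerSum r (2 - 2 * t') D' F) (h2' : IsPowerSum r (2 + 2 * t') D' G) :
    t = t' ∧ D = D' := by
  have hD : D = D' := le_antisymm (not_lt.1 (IsPowerSum.not_product_lt hr0 hr1 h1' h2' h1 h2))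
    (not_lt.1 (IsPowerSum.not_product_lt hr0 hr1 h1 h2 h1' h2'))
  subst hD
  have h3 := h1.not_lt_left hr0 h1'
  have h4 := h1'.not_lt_left hr0 h1
  exact ⟨by linarith, rfl⟩

end PowerSums

/-! ### Singular values of operators of rank at most two. -/

section LowRank

variable {E F : Type*} [NormedAddCommGroup E] [InnerProductSpace ℂ E] [CompleteSpace E]
  [NormedAddCommGroup F] [InnerProductSpace ℂ F] [CompleteSpace F] {ι κ : Type*}

open ContinuousLinearMap InnerProductSpace

theorem isCompactOperator_rankOne (f : F) (u : E) : IsCompactOperator (rankOne ℂ f u) := by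
  rw [rankOne_def']
  have h : IsCompactOperator (innerSL ℂ u) :=
    isCompactOperator_of_locallyCompactSpace_dom (innerSL ℂ u)
  exact h.clm_comp (ContinuousLinearMap.toSpanSingleton ℂ f)

/-- The Hilbert–Schmidt norm of a difference of two rank-one operators; the general X, Y let it
serve for both a and a†a. -/
theorem hasSum_sq_norm_smul_sub_smul (b : HilbertBasis κ ℂ E) (u w : E) (X Y : F) :
    HasSum (fun k => ‖⟪u, b k⟫_ℂ • X - ⟪w, b k⟫_ℂ • Y‖ ^ 2)
      (‖u‖ ^ 2 * ‖X‖ ^ 2 + ‖w‖ ^ 2 * ‖Y‖ ^ 2 - 2 * (⟪w, u⟫_ℂ * ⟪X, Y⟫_ℂ).re) := by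
  have h1 := (b.hasSum_sq_norm_inner u).mul_right (‖X‖ ^ 2)
  have h2 := (b.hasSum_sq_norm_inner w).mul_right (‖Y‖ ^ 2)
  have h3 := (Complex.hasSum_re ((b.hasSum_inner_mul_inner w u).mul_right ⟪X, Y⟫_ℂ)).mul_left 2
  convert! (h1.add h2).sub h3 using 1
  ext k
  rw [@norm_sub_sq ℂ, inner_smul_left, inner_smul_right, inner_conj_symm, norm_smul, norm_smul,
    norm_inner_symm u, norm_inner_symm w]
  have : ⟪b k, u⟫_ℂ * (⟪w, b k⟫_ℂ * ⟪X, Y⟫_ℂ) = ⟪w, b k⟫_ℂ * ⟪b k, u⟫_ℂ * ⟪X, Y⟫_ℂ := by ring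
  rw [this]
  change _ - 2 * (_ : ℂ).re + _ = _
  ring

theorem exists_hasSum_of_ncard_support_le_two {t : κ → ℝ} (ht0 : ∀ k, 0 ≤ t k)
    (hf : {k | t k ≠ 0}.Finite) (hc : {k | t k ≠ 0}.ncard ≤ 2) :
    ∃ X Y : ℝ, 0 ≤ X ∧ 0 ≤ Y ∧
      ∀ φ : ℝ → ℝ, φ 0 = 0 → HasSum (fun k => φ (t k)) (φ X + φ Y) := by
  have hsupp : ∀ φ : ℝ → ℝ, φ 0 = 0 → ∀ k ∉ hf.toFinset, φ (t k) = 0 := by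
    intro φ h0 k hk
    have : t k = 0 := by simpa using hk
    rw [this, h0]
  rw [Set.ncard_eq_toFinset_card _ hf] at hc
  classical
  obtain h | h | h : hf.toFinset.card = 0 ∨ hf.toFinset.card = 1 ∨ hf.toFinset.card = 2 := by
    omega
  · refine ⟨0, 0, le_rfl, le_rfl, fun φ h0 => ?_⟩
    have : HasSum (fun k => φ (t k)) _ := hasSum_sum_of_ne_finset_zero (hsupp φ h0)
    rw [Finset.card_eq_zero] at h
    simpa [h, h0] using this
  · obtain ⟨k, hk⟩ := Finset.card_eq_one.1 h
    refine ⟨t k, 0, ht0 k, le_rfl, fun φ h0 => ?_⟩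
    have : HasSum (fun k => φ (t k)) _ := hasSum_sum_of_ne_finset_zero (hsupp φ h0)
    simpa [hk, h0] using this
  · obtain ⟨k, l, hkl, hk⟩ := Finset.card_eq_two.1 h
    refine ⟨t k, t l, ht0 k, ht0 l, fun φ h0 => ?_⟩
    have : HasSum (fun k => φ (t k)) _ := hasSum_sum_of_ne_finset_zero (hsupp φ h0)
    rwa [hk, Finset.sum_pair hkl] at this

theorem finite_ncard_singular_le_two {a : E →L[ℂ] F} (b : HilbertBasis κ ℂ E)
    (hb : ∀ k, (a†) (a (b k)) = ((‖a (b k)‖ ^ 2 : ℝ) : ℂ) • b k) {f g : F}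
    (ha : ∀ h, a h ∈ Submodule.span ℂ {f, g}) :
    {k | ‖a (b k)‖ ^ 2 ≠ 0}.Finite ∧ {k | ‖a (b k)‖ ^ 2 ≠ 0}.ncard ≤ 2 := by
  have hset : {k | ‖a (b k)‖ ^ 2 ≠ 0} = {k | a (b k) ≠ 0} := by
    ext k
    simp
  rw [hset]
  set V := Submodule.span ℂ ({f, g} : Set F) with hV
  have : FiniteDimensional ℂ V := FiniteDimensional.span_of_finite ℂ (Set.toFinite _)
  have hrank : Module.finrank ℂ V ≤ 2 := by
    classical
    refine (finrank_span_le_card (R := ℂ) ({f, g} : Set F)).trans ?_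
    rw [Set.toFinset_card]
    simpa using Finset.card_le_two (a := f) (b := g)
  have hmem : ∀ k, leftSingular a b k ∈ V := fun k => V.smul_mem _ (ha _)
  have hli : LinearIndependent ℂ
      (fun k : {k // a (b k) ≠ 0} => (⟨leftSingular a b k, hmem k⟩ : V)) := by
    apply LinearIndependent.of_comp V.subtype
    exact (orthonormal_leftSingular b hb).linearIndependent
  have hfin : Finite {k // a (b k) ≠ 0} := hli.finite
  refine ⟨Set.finite_coe_iff.1 hfin, ?_⟩
  have := Fintype.ofFinite {k // a (b k) ≠ 0}
  have h1 := hli.fintype_card_le_finrank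
  rw [← Nat.card_eq_fintype_card] at h1
  exact h1.trans hrank

universe u
-- X and Y are the squared singular values, padded by zeros. The first two sums are the traces of
-- a†a and (a†a)², which determine X + Y and XY without diagonalising.
theorem exists_schattenSum_eq_of_mem_span {E : Type u} [NormedAddCommGroup E]
    [InnerProductSpace ℂ E] [CompleteSpace E] {p : ℝ} (hp : 0 < p) {a : E →L[ℂ] F}
    (hac : IsCompactOperator a) {f g : F} (ha : ∀ h, a h ∈ Submodule.span ℂ {f, g}) :
    ∃ (κ : Type u) (b : HilbertBasis κ ℂ E) (X Y : ℝ), 0 ≤ X ∧ 0 ≤ Y ∧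
      HasSum (fun k => ‖a (b k)‖ ^ 2) (X + Y) ∧
      HasSum (fun k => ‖(a†) (a (b k))‖ ^ 2) (X ^ 2 + Y ^ 2) ∧
      schattenSum p a = ENNReal.ofReal (X ^ (p / 2) + Y ^ (p / 2)) := by
  obtain ⟨κ, b, hb⟩ := exists_eigenbasis hac
  obtain ⟨hfin, hcard⟩ := finite_ncard_singular_le_two b hb ha
  obtain ⟨X, Y, hX, hY, h⟩ := exists_hasSum_of_ncard_support_le_two
    (t := fun k => ‖a (b k)‖ ^ 2) (fun k => by positivity) hfin hcard
  refine ⟨κ, b, X, Y, hX, hY, h id rfl, ?_, ?_⟩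
  · convert! h (fun t => t ^ 2) (by norm_num) using 1
    ext k
    rw [hb, norm_smul, b.orthonormal.1 k]
    simp
  · have h1 := h (fun t => t ^ (p / 2)) (Real.zero_rpow (by positivity))
    rw [schattenSum_eq_tsum hp hac b fun k => ⟨_, hb k⟩, ← h1.tsum_eq,
      ENNReal.ofReal_tsum_of_nonneg (fun k => by positivity) h1.summable]
    simp_rw [enorm_rpow_eq_ofReal _ hp]

theorem schattenSum_rankOne {p : ℝ} (hp : 0 < p) (f : F) (u : E) :
    schattenSum p (rankOne ℂ f u) = ENNReal.ofReal ((‖f‖ * ‖u‖) ^ p) := by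
  obtain ⟨κ, b, X, Y, hX, hY, h1, h2, h3⟩ := exists_schattenSum_eq_of_mem_span hp
    (isCompactOperator_rankOne f u) (f := f) (g := f) (fun h => by
      rw [rankOne_apply]
      exact Submodule.smul_mem _ _ (Submodule.subset_span (by simp)))
  have h4 := hasSum_sq_norm_smul_sub_smul b u 0 f (0 : F)
  have h5 := hasSum_sq_norm_smul_sub_smul b u 0 ((‖f‖ ^ 2 : ℂ) • u) (0 : E)
  have e1 : X + Y = ‖u‖ ^ 2 * ‖f‖ ^ 2 := by
    refine h1.unique ?_
    simpa [rankOne_apply] using h4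
  have e2 : X ^ 2 + Y ^ 2 = ‖u‖ ^ 2 * (‖f‖ ^ 2 * ‖u‖) ^ 2 := by
    refine h2.unique ?_
    simpa [rankOne_apply, adjoint_rankOne, norm_smul, inner_smul_right,
      inner_self_eq_norm_sq_to_K] using h5
  have e3 : X * Y = 0 := by
    have : (X + Y) ^ 2 = X ^ 2 + Y ^ 2 := by
      rw [e1, e2]
      ring
    nlinarith
  have e4 : X ^ (p / 2) + Y ^ (p / 2) = ((‖f‖ * ‖u‖) ^ 2) ^ (p / 2) := by
    have hz : (0 : ℝ) ^ (p / 2) = 0 := Real.zero_rpow (by positivity)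
    rcases mul_eq_zero.1 e3 with h | h
    · rw [h, hz, zero_add]
      congr 1
      rw [h, zero_add] at e1
      rw [e1]
      ring
    · rw [h, hz, add_zero]
      congr 1
      rw [h, add_zero] at e1
      rw [e1]
      ring
  rw [h3, e4, ← Real.rpow_natCast, ← Real.rpow_mul (by positivity)]
  congr 2
  push_cast
  ring

theorem exists_schattenSum_rankOne_sub {p : ℝ} (hp : 0 < p) {f g : F} {u w : E}
    (hf : ‖f‖ = 1) (hg : ‖g‖ = 1) (hu : ‖u‖ = 1) (hw : ‖w‖ = 1) :
    ∃ G : ℝ, 0 ≤ G ∧ schattenSum p (rankOne ℂ f u - rankOne ℂ g w) = ENNReal.ofReal G ∧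
      IsPowerSum (p / 2) (2 - 2 * (⟪f, g⟫_ℂ * ⟪w, u⟫_ℂ).re)
        ((1 - ‖⟪f, g⟫_ℂ‖ ^ 2) * (1 - ‖⟪w, u⟫_ℂ‖ ^ 2)) G := by
  set a := rankOne ℂ f u - rankOne ℂ g w with hadef
  have happ : ∀ h, a h = ⟪u, h⟫_ℂ • f - ⟪w, h⟫_ℂ • g := fun h => by
    simp [hadef, rankOne_apply]
  have hadj : ∀ h, (a†) h = ⟪f, h⟫_ℂ • u - ⟪g, h⟫_ℂ • w := fun h => by
    simp [hadef, adjoint_rankOne, rankOne_apply]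
  obtain ⟨κ, b, X, Y, hX, hY, h1, h2, h3⟩ := exists_schattenSum_eq_of_mem_span hp (a := a)
    ((isCompactOperator_rankOne f u).sub (isCompactOperator_rankOne g w)) (f := f) (g := g)
    (fun h => by
      rw [happ]
      exact Submodule.sub_mem _ (Submodule.smul_mem _ _ (Submodule.subset_span (by simp)))
        (Submodule.smul_mem _ _ (Submodule.subset_span (by simp))))
  refine ⟨_, by positivity, h3, X, Y, hX, hY, ?_, ?_, rfl⟩
  · refine h1.unique ?_
    have := hasSum_sq_norm_smul_sub_smul b u w f g
    simp only [← happ, hf, hg, hu, hw] at this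
    convert! this using 1
    rw [mul_comm ⟪w, u⟫_ℂ]
    ring
  · have e1 : X + Y = 2 - 2 * (⟪f, g⟫_ℂ * ⟪w, u⟫_ℂ).re := by
      refine h1.unique ?_
      have := hasSum_sq_norm_smul_sub_smul b u w f g
      simp only [← happ, hf, hg, hu, hw] at this
      convert! this using 1
      rw [mul_comm ⟪w, u⟫_ℂ]
      ring
    -- a†a h = ⟨u,h⟩ a†f - ⟨w,h⟩ a†g has the same two-term form, so the trace of (a†a)² is explicit.
    have h4 := hasSum_sq_norm_smul_sub_smul b u w ((a†) f) ((a†) g)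
    simp only [← map_smul, ← map_sub, ← happ, hu, hw] at h4
    have e2 := h2.unique h4
    have hff : ⟪f, f⟫_ℂ = 1 := by simp [inner_self_eq_norm_sq_to_K, hf]
    have hgg : ⟪g, g⟫_ℂ = 1 := by simp [inner_self_eq_norm_sq_to_K, hg]
    have huu : ⟪u, u⟫_ℂ = 1 := by simp [inner_self_eq_norm_sq_to_K, hu]
    have hww : ⟪w, w⟫_ℂ = 1 := by simp [inner_self_eq_norm_sq_to_K, hw]
    have hsq : ∀ z : E, ‖z‖ ^ 2 = (⟪z, z⟫_ℂ).re := fun z => by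
      rw [inner_self_eq_norm_sq_to_K]
      norm_cast
    have hsq' : ∀ z : ℂ, ‖z‖ ^ 2 = z.re * z.re + z.im * z.im := fun z => by
      rw [Complex.sq_norm, Complex.normSq_apply]
    rw [hsq, hsq, hadj, hadj] at e2
    simp only [inner_sub_left, inner_sub_right, inner_smul_left, inner_smul_right, hff, hgg, huu,
      hww, map_one] at e2
    rw [← inner_conj_symm g f, ← inner_conj_symm u w] at e2
    generalize ⟪f, g⟫_ℂ = c at *
    generalize ⟪w, u⟫_ℂ = q at *
    rw [hsq', hsq']
    simp only [Complex.sub_re, Complex.mul_re, Complex.mul_im, Complex.one_re, Complex.one_im,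
      Complex.conj_re, Complex.conj_im, Complex.sub_im] at e1 e2
    have e3 : (X + Y) ^ 2 = X ^ 2 + Y ^ 2 + 2 * (X * Y) := by ring
    rw [e1, e2] at e3
    linear_combination (-1 / 2) * e3

end LowRank

/-! ### Minimal partial isometries, Peirce components and orthogonality. -/

section RankOne

variable {H : Type*} [NormedAddCommGroup H] [InnerProductSpace ℂ H] [CompleteSpace H]

open ContinuousLinearMap InnerProductSpace

theorem isMinimalPartialIsometry_rankOne {f u : H} (hf : ‖f‖ = 1) (hu : ‖u‖ = 1) :
    IsMinimalPartialIsometry (rankOne ℂ f u) := by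
  refine ⟨?_, ?_⟩
  · ext h
    simp [star_eq_adjoint, adjoint_rankOne, rankOne_apply, inner_self_eq_norm_sq_to_K, hf, hu,
      inner_smul_right]
  · have hf0 : f ≠ 0 := fun h => by simp [h] at hf
    have : LinearMap.range ((rankOne ℂ f u : H →L[ℂ] H) : H →ₗ[ℂ] H) = Submodule.span ℂ {f} := by
      ext z
      rw [Submodule.mem_span_singleton, LinearMap.mem_range]
      constructor
      · rintro ⟨h, rfl⟩
        exact ⟨⟪u, h⟫_ℂ, rfl⟩
      · rintro ⟨c, rfl⟩
        refine ⟨c • u, ?_⟩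
        simp [rankOne_apply, inner_smul_right, inner_self_eq_norm_sq_to_K, hu]
    rw [this]
    exact finrank_span_singleton hf0

theorem IsMinimalPartialIsometry.exists_eq_rankOne {e : H →L[ℂ] H}
    (he : IsMinimalPartialIsometry e) :
    ∃ f u : H, ‖f‖ = 1 ∧ ‖u‖ = 1 ∧ e = rankOne ℂ f u := by
  obtain ⟨h1, h2⟩ := he
  obtain ⟨⟨z, hz⟩, hz0, hspan⟩ := finrank_eq_one_iff'.1 h2
  have hz0' : z ≠ 0 := fun h => hz0 (Subtype.ext h)
  set f : H := ((‖z‖⁻¹ : ℝ) : ℂ) • z with hfdef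
  have hnz : ‖z‖ ≠ 0 := norm_ne_zero_iff.2 hz0'
  have hf : ‖f‖ = 1 := by
    rw [hfdef, norm_smul, Complex.norm_real, norm_inv, norm_norm, inv_mul_cancel₀ hnz]
  have hzf : z = (‖z‖ : ℂ) • f := by
    rw [hfdef, smul_smul, ← Complex.ofReal_mul, mul_inv_cancel₀ hnz]
    simp
  have hrep : e = rankOne ℂ f ((e†) f) := by
    ext y
    obtain ⟨c, hc⟩ := hspan ⟨e y, ⟨y, rfl⟩⟩
    have hc' : e y = (c * ‖z‖) • f := by
      rw [mul_smul, ← hzf]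
      exact (congrArg Subtype.val hc).symm
    rw [rankOne_apply, adjoint_inner_left, hc', inner_smul_right, inner_self_eq_norm_sq_to_K, hf]
    simp
  set u := (e†) f with hu
  refine ⟨f, u, hf, ?_, hrep⟩
  have hf0 : f ≠ 0 := fun h => by simp [h] at hf
  have hu0 : u ≠ 0 := by
    intro h0
    obtain ⟨y, hy⟩ := hz
    rw [hrep, h0] at hy
    apply hz0'
    rw [← hy]
    simp
  rw [hrep, star_eq_adjoint, adjoint_rankOne] at h1
  have h3 := congrArg (fun T : H →L[ℂ] H => T u) h1
  change rankOne ℂ f u (rankOne ℂ u f (rankOne ℂ f u u)) = rankOne ℂ f u u at h3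
  simp only [rankOne_apply, map_smul, smul_smul, inner_self_eq_one_of_norm_eq_one hf,
    inner_self_eq_norm_sq_to_K, one_mul, inner_smul_right, mul_one] at h3
  have h4 := smul_left_injective ℂ hf0 h3
  have h5 : (‖u‖ ^ 2 : ℝ) * ‖u‖ ^ 2 = ‖u‖ ^ 2 := by
    have : (((‖u‖ ^ 2 : ℝ) * ‖u‖ ^ 2 : ℝ) : ℂ) = ((‖u‖ ^ 2 : ℝ) : ℂ) := by
      push_cast
      simpa using h4
    exact_mod_cast this
  have hnu : ‖u‖ ^ 2 ≠ 0 := pow_ne_zero 2 (norm_ne_zero_iff.2 hu0)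
  have h6 : ‖u‖ ^ 2 = 1 := mul_right_cancel₀ hnu (by rw [h5, one_mul])
  exact (pow_eq_one_iff_of_nonneg (norm_nonneg u) two_ne_zero).1 h6

theorem peirceTwo_eq_peirceCoeff_smul {e : H →L[ℂ] H} (he : IsMinimalPartialIsometry e)
    (x : H →L[ℂ] H) : peirceTwo e x = peirceCoeff e x • e := by
  rw [peirceCoeff, dif_pos he]
  exact (he.existsUnique_coeff x).choose_spec.1

theorem peirceCoeff_rankOne {f u g w : H} (hf : ‖f‖ = 1) (hu : ‖u‖ = 1) :
    peirceCoeff (rankOne ℂ f u) (rankOne ℂ g w) = ⟪f, g⟫_ℂ * ⟪w, u⟫_ℂ := by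
  have he := isMinimalPartialIsometry_rankOne hf hu
  refine (he.existsUnique_coeff (rankOne ℂ g w)).unique (peirceTwo_eq_peirceCoeff_smul he _) ?_
  have huu := inner_self_eq_one_of_norm_eq_one (𝕜 := ℂ) hu
  have hff := inner_self_eq_one_of_norm_eq_one (𝕜 := ℂ) hf
  rw [peirceTwo, star_eq_adjoint, adjoint_rankOne]
  ext h
  change rankOne ℂ f u (rankOne ℂ u f (rankOne ℂ g w (rankOne ℂ u f (rankOne ℂ f u h)))) =
    (⟪f, g⟫_ℂ * ⟪w, u⟫_ℂ) • rankOne ℂ f u h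
  simp only [rankOne_apply, map_smul, smul_smul, huu, hff, inner_smul_right, mul_one]
  congr 1
  ring

theorem norm_sq_sub_inner_smul {f : H} (hf : ‖f‖ = 1) (g : H) :
    ‖g - ⟪f, g⟫_ℂ • f‖ ^ 2 = ‖g‖ ^ 2 - ‖⟪f, g⟫_ℂ‖ ^ 2 := by
  rw [@norm_sub_sq ℂ, inner_smul_right, ← inner_conj_symm g f, RCLike.mul_conj, norm_smul, hf]
  norm_cast
  ring

theorem peirceZero_rankOne (f u g w : H) :
    peirceZero (rankOne ℂ f u) (rankOne ℂ g w) =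
      rankOne ℂ (g - (⟪u, u⟫_ℂ * ⟪f, g⟫_ℂ) • f) (w - (⟪f, f⟫_ℂ * ⟪u, w⟫_ℂ) • u) := by
  have hP : ∀ z, (1 - rankOne ℂ f u * rankOne ℂ u f) z = z - (⟪u, u⟫_ℂ * ⟪f, z⟫_ℂ) • f := by
    intro z
    change z - rankOne ℂ f u (rankOne ℂ u f z) = _
    rw [rankOne_apply, rankOne_apply, inner_smul_right, mul_comm]
  have hQ : ∀ z, (1 - rankOne ℂ u f * rankOne ℂ f u) z = z - (⟪f, f⟫_ℂ * ⟪u, z⟫_ℂ) • u := by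
    intro z
    change z - rankOne ℂ u f (rankOne ℂ f u z) = _
    rw [rankOne_apply, rankOne_apply, inner_smul_right, mul_comm]
  rw [peirceZero, star_eq_adjoint, adjoint_rankOne]
  ext h
  change (1 - rankOne ℂ f u * rankOne ℂ u f)
    (rankOne ℂ g w ((1 - rankOne ℂ u f * rankOne ℂ f u) h)) = _
  rw [hQ, rankOne_apply, map_smul, hP, rankOne_apply]
  congr 1
  rw [inner_sub_left, inner_sub_right, inner_smul_left, inner_smul_right, map_mul,
    inner_conj_symm, inner_conj_symm]
  ring

/-- P_0(e)(v) is the rank-one operator built from the components of g and w orthogonal to f and u,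
so its norm is the square root of the product occurring in `exists_schattenSum_rankOne_sub`. -/
theorem schattenSum_peirceZero_rankOne {p : ℝ} (hp : 0 < p) {f u g w : H}
    (hf : ‖f‖ = 1) (hu : ‖u‖ = 1) (hg : ‖g‖ = 1) (hw : ‖w‖ = 1) :
    schattenSum p (peirceZero (rankOne ℂ f u) (rankOne ℂ g w)) =
      ENNReal.ofReal (((1 - ‖⟪f, g⟫_ℂ‖ ^ 2) * (1 - ‖⟪w, u⟫_ℂ‖ ^ 2)) ^ (p / 2)) := by
  have h1 := norm_sq_sub_inner_smul hf g
  have h2 := norm_sq_sub_inner_smul hu w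
  rw [hg, one_pow] at h1
  rw [hw, norm_inner_symm, one_pow] at h2
  rw [peirceZero_rankOne, schattenSum_rankOne hp, inner_self_eq_one_of_norm_eq_one hf,
    inner_self_eq_one_of_norm_eq_one hu, one_mul, one_mul, ← h1, ← h2, ← mul_pow,
    ← Real.rpow_natCast, ← Real.rpow_mul (by positivity)]
  congr 2
  push_cast
  ring

/-- Orthogonality of operators: both the initial and the final spaces are orthogonal. -/
def IsOrtho (x y : H →L[ℂ] H) : Prop := x† ∘L y = 0 ∧ y ∘L x† = 0

theorem isOrtho_rankOne_rankOne {f u g w : H} (h1 : ⟪f, g⟫_ℂ = 0) (h2 : ⟪w, u⟫_ℂ = 0) :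
    IsOrtho (rankOne ℂ f u) (rankOne ℂ g w) := by
  constructor
  · ext h
    simp [adjoint_rankOne, rankOne_apply, inner_smul_right, h1]
  · ext h
    simp [adjoint_rankOne, rankOne_apply, inner_smul_right, h2]

theorem isOrtho_smul_iff {x y : H →L[ℂ] H} {c : ℂ} (hc : c ≠ 0) :
    IsOrtho (c • x) y ↔ IsOrtho x y := by
  have h : (c • x)† = starRingEnd ℂ c • x† := by simp [map_smulₛₗ]
  rw [IsOrtho, IsOrtho, h, smul_comp, comp_smul, smul_eq_zero_iff_right (by simpa using hc),
    smul_eq_zero_iff_right (by simpa using hc)]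

theorem ENNReal.rpow_eq_one_iff_of_pos {x : ENNReal} {y : ℝ} (hy : 0 < y) :
    x ^ y = 1 ↔ x = 1 := by
  rw [← ENNReal.one_rpow y, (ENNReal.rpow_left_injective hy.ne').eq_iff, ENNReal.one_rpow]

theorem mem_schattenSphere_iff {p : ℝ} (hp : 0 < p) {a : H →L[ℂ] H} :
    a ∈ schattenSphere H p ↔ IsCompactOperator a ∧ schattenSum p a = 1 := by
  have h1 : schattenNorm p a = 1 ↔ schattenSum p a = 1 := by
    rw [schattenNorm_eq_schattenSum_rpow, ENNReal.rpow_eq_one_iff_of_pos (by positivity)]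
  constructor
  · rintro ⟨⟨hc, -⟩, h⟩
    exact ⟨hc, h1.1 h⟩
  · rintro ⟨hc, h⟩
    refine ⟨⟨hc, ?_⟩, h1.2 h⟩
    rw [h1.2 h]
    exact ENNReal.one_lt_top

theorem rankOne_mem_schattenSphere {p : ℝ} (hp : 0 < p) {f u : H} (hf : ‖f‖ = 1) (hu : ‖u‖ = 1) :
    rankOne ℂ f u ∈ schattenSphere H p := by
  rw [mem_schattenSphere_iff hp, schattenSum_rankOne hp, hf, hu]
  exact ⟨isCompactOperator_rankOne f u, by simp⟩

/-- Nonzero orthogonal vectors u, w cannot both lie on the line through f; this supplies the second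
leg of a rank-one test operator. -/
theorem exists_unit_ortho {u w f : H} (hu : ‖u‖ = 1) (hf : ‖f‖ = 1) (hw : w ≠ 0)
    (huw : ⟪u, w⟫_ℂ = 0) : ∃ g : H, ‖g‖ = 1 ∧ ⟪f, g⟫_ℂ = 0 := by
  have key : ∀ z : H, ⟪f, z - ⟪f, z⟫_ℂ • f⟫_ℂ = 0 := fun z => by
    simp [inner_sub_right, inner_smul_right, inner_self_eq_norm_sq_to_K, hf]
  have hnorm : ∀ z : H, z ≠ 0 → ⟪f, z⟫_ℂ = 0 → ∃ g : H, ‖g‖ = 1 ∧ ⟪f, g⟫_ℂ = 0 := by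
    intro z hz hfz
    refine ⟨((‖z‖⁻¹ : ℝ) : ℂ) • z, ?_, by rw [inner_smul_right, hfz, mul_zero]⟩
    rw [norm_smul, Complex.norm_real, norm_inv, norm_norm,
      inv_mul_cancel₀ (norm_ne_zero_iff.2 hz)]
  by_cases h1 : u - ⟪f, u⟫_ℂ • f = 0
  · by_cases h2 : w - ⟪f, w⟫_ℂ • f = 0
    · exfalso
      rw [sub_eq_zero] at h1 h2
      rw [h1, h2, inner_smul_left, inner_smul_right, inner_self_eq_one_of_norm_eq_one hf,
        mul_one, mul_eq_zero, map_eq_zero] at huw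
      rcases huw with h | h
      · rw [h, zero_smul] at h1
        simp [h1] at hu
      · rw [h, zero_smul] at h2
        exact hw h2
    · exact hnorm _ h2 (key w)
  · exact hnorm _ h1 (key u)

/-- Testing with rank-one operators orthogonal to f ⊗ u shows that b kills the complement of u and
b† kills the complement of f. -/
theorem exists_eq_smul_of_isOrtho_imp {p : ℝ} (hp : 0 < p) {f u : H} (hf : ‖f‖ = 1)
    (hu : ‖u‖ = 1) {b : H →L[ℂ] H}
    (h : ∀ c ∈ schattenSphere H p, IsOrtho (rankOne ℂ f u) c → IsOrtho b c) :
    ∃ c : ℂ, b = c • rankOne ℂ f u := by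
  have hpair : ∀ g w : H, ‖g‖ = 1 → ‖w‖ = 1 → ⟪f, g⟫_ℂ = 0 → ⟪u, w⟫_ℂ = 0 →
      (b†) g = 0 ∧ b w = 0 := by
    intro g w hg hw hfg huw
    obtain ⟨h1, h2⟩ := h _ (rankOne_mem_schattenSphere hp hg hw)
      (isOrtho_rankOne_rankOne hfg (by rw [← inner_conj_symm, huw, map_zero]))
    constructor
    · have := congrArg (fun T : H →L[ℂ] H => T w) h1
      simpa [rankOne_apply, inner_self_eq_norm_sq_to_K, hw] using this
    · have hg0 : g ≠ 0 := fun h => by simp [h] at hg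
      have h3 : ∀ z, ⟪w, (b†) z⟫_ℂ = 0 := fun z => by
        have := congrArg (fun T : H →L[ℂ] H => T z) h2
        simpa [rankOne_apply, hg0] using this
      refine ext_inner_right ℂ fun z => ?_
      rw [← adjoint_inner_right, h3, inner_zero_left]
  have hnormalize : ∀ z : H, z ≠ 0 → ‖((‖z‖⁻¹ : ℝ) : ℂ) • z‖ = 1 := fun z hz => by
    rw [norm_smul, Complex.norm_real, norm_inv, norm_norm, inv_mul_cancel₀ (norm_ne_zero_iff.2 hz)]
  have hker : ∀ w, ⟪u, w⟫_ℂ = 0 → b w = 0 := fun w hw => by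
    by_cases hw0 : w = 0
    · rw [hw0, map_zero]
    obtain ⟨g, hg, hfg⟩ := exists_unit_ortho hu hf hw0 hw
    have := (hpair g _ hg (hnormalize w hw0) hfg (by rw [inner_smul_right, hw, mul_zero])).2
    simpa [hw0] using this
  have hker' : ∀ g, ⟪f, g⟫_ℂ = 0 → (b†) g = 0 := fun g hg => by
    by_cases hg0 : g = 0
    · rw [hg0, map_zero]
    obtain ⟨w, hw, huw⟩ := exists_unit_ortho hf hu hg0 hg
    have := (hpair _ w (hnormalize g hg0) hw (by rw [inner_smul_right, hg, mul_zero]) huw).1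
    simpa [hg0] using this
  refine ⟨⟪f, b u⟫_ℂ, ?_⟩
  ext z
  have h1 : b z = ⟪u, z⟫_ℂ • b u := by
    have := hker (z - ⟪u, z⟫_ℂ • u) (by
      rw [inner_sub_right, inner_smul_right, inner_self_eq_one_of_norm_eq_one hu, mul_one,
        sub_self])
    rwa [map_sub, map_smul, sub_eq_zero] at this
  have h2 : b u = ⟪f, b u⟫_ℂ • f := by
    refine ext_inner_left ℂ fun y => ?_
    have := hker' (y - ⟪f, y⟫_ℂ • f) (by
      rw [inner_sub_right, inner_smul_right, inner_self_eq_one_of_norm_eq_one hf, mul_one,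
        sub_self])
    rw [map_sub, map_smul, sub_eq_zero] at this
    rw [← adjoint_inner_left, this, inner_smul_left, inner_smul_right, adjoint_inner_left,
      inner_conj_symm, mul_comm]
  rw [h1, smul_apply, rankOne_apply, smul_comm, ← h2]

/-- If `a` had two nonzero singular components, the annihilator of one of them would contain that of
`a`, and strictly so: it contains the other component, which is not orthogonal to `a`. -/
theorem exists_eq_rankOne_of_isOrtho_maximal {p : ℝ} (hp : 0 < p) {a : H →L[ℂ] H}
    (ha : a ∈ schattenSphere H p)
    (h : ∀ b ∈ schattenSphere H p, (∀ c ∈ schattenSphere H p, IsOrtho a c → IsOrtho b c) →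
      ∀ c ∈ schattenSphere H p, IsOrtho b c → IsOrtho a c) :
    ∃ f u : H, ‖f‖ = 1 ∧ ‖u‖ = 1 ∧ a = rankOne ℂ f u := by
  obtain ⟨hac, ha1⟩ := (mem_schattenSphere_iff hp).1 ha
  obtain ⟨κ, e, he⟩ := exists_eigenbasis hac
  have hon := orthonormal_leftSingular e he
  have hne : ∀ k, a (e k) ≠ 0 → ((‖a (e k)‖ ^ 2 : ℝ) : ℂ) ≠ 0 := fun k hk => by
    exact_mod_cast pow_ne_zero 2 (norm_ne_zero_iff.2 hk)
  obtain ⟨i, hi⟩ : ∃ i, a (e i) ≠ 0 := by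
    by_contra! hall
    rw [schattenSum_eq_tsum hp hac e fun k => ⟨_, he k⟩] at ha1
    simp [hall, hp] at ha1
  have hsingle : ∀ j, j ≠ i → a (e j) = 0 := by
    intro j hji
    by_contra hj
    have hbc : ∀ c ∈ schattenSphere H p, IsOrtho a c →
        IsOrtho (rankOne ℂ (leftSingular a e i) (e i)) c := by
      rintro c - ⟨h1, h2⟩
      have h3 : ∀ z, ⟪a (e i), c z⟫_ℂ = 0 := fun z => by
        rw [← adjoint_inner_right]
        have := congrArg (fun T : H →L[ℂ] H => T z) h1
        change (a†) (c z) = 0 at this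
        rw [this, inner_zero_right]
      have h4 : c (e i) = 0 := by
        have := congrArg (fun T : H →L[ℂ] H => T (a (e i))) h2
        change c ((a†) (a (e i))) = 0 at this
        rw [he, map_smul] at this
        exact (smul_eq_zero.1 this).resolve_left (hne i hi)
      constructor
      · ext z
        rw [adjoint_rankOne]
        change rankOne ℂ (e i) (leftSingular a e i) (c z) = 0
        rw [rankOne_apply, leftSingular, inner_smul_left, h3, mul_zero, zero_smul]
      · ext z
        simp [adjoint_rankOne, rankOne_apply, h4]
    have hmem : ∀ k, a (e k) ≠ 0 → rankOne ℂ (leftSingular a e k) (e k) ∈ schattenSphere H p :=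
      fun k hk => rankOne_mem_schattenSphere hp (hon.1 ⟨k, hk⟩) (e.orthonormal.1 k)
    obtain ⟨h1, -⟩ := h _ (hmem i hi) hbc _ (hmem j hj)
      (isOrtho_rankOne_rankOne (hon.2 (i := ⟨i, hi⟩) (j := ⟨j, hj⟩)
        (fun hij => hji (congrArg Subtype.val hij).symm)) (e.orthonormal.2 hji))
    have h2 := congrArg (fun T : H →L[ℂ] H => T (e j)) h1
    simp only [coe_comp, Function.comp_apply, rankOne_apply, inner_self_eq_norm_sq_to_K,
      e.orthonormal.1 j, leftSingular, map_smul, he, zero_apply] at h2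
    have h3 : e j = 0 := by
      rcases (by simpa [hj] using h2 : e j = 0 ∨ (a†) (a (e j)) = 0) with h3 | h3
      · exact h3
      · rw [he j] at h3
        exact (smul_eq_zero.1 h3).resolve_left (hne j hj)
    have h4 := e.orthonormal.1 j
    simp [h3] at h4
  have hrep : a = rankOne ℂ (a (e i)) (e i) := by
    ext z
    have h1 := a.hasSum (e.hasSum_repr z)
    refine h1.unique ?_
    rw [rankOne_apply, ← e.repr_apply_apply]
    have h2 := hasSum_single (f := fun k => a ((e.repr z) k • e k)) i
      (fun j hj => by simp [hsingle j hj])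
    rwa [map_smul] at h2
  refine ⟨a (e i), e i, ?_, e.orthonormal.1 i, hrep⟩
  rw [hrep, schattenSum_rankOne hp, e.orthonormal.1 i, mul_one, ENNReal.ofReal_eq_one] at ha1
  rwa [← Real.rpow_left_inj (norm_nonneg _) zero_le_one hp.ne', Real.one_rpow]

theorem schattenSum_smul {p : ℝ} (hp : 0 < p) {a : H →L[ℂ] H} (ha : IsCompactOperator a) (c : ℂ) :
    schattenSum p (c • a) = ‖c‖ₑ ^ p * schattenSum p a := by
  obtain ⟨κ, e, he⟩ := exists_eigenbasis ha
  rw [schattenSum_eq_tsum hp ha e fun k => ⟨_, he k⟩, ← ENNReal.tsum_mul_left,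
    schattenSum_eq_tsum hp (T := c • a) (ha.smul c) e]
  · refine tsum_congr fun k => ?_
    rw [smul_apply, enorm_smul, ENNReal.mul_rpow_of_nonneg _ _ hp.le]
  · intro k
    refine ⟨starRingEnd ℂ c * c * ((‖a (e k)‖ ^ 2 : ℝ) : ℂ), ?_⟩
    simp only [map_smulₛₗ, smul_apply, he, smul_smul]
    congr 1
    simp
    ring

theorem norm_eq_one_of_smul_mem_schattenSphere {p : ℝ} (hp : 0 < p) {a : H →L[ℂ] H} {c : ℂ}
    (ha : a ∈ schattenSphere H p) (hca : c • a ∈ schattenSphere H p) : ‖c‖ = 1 := by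
  obtain ⟨h1, h2⟩ := (mem_schattenSphere_iff hp).1 ha
  have h3 := ((mem_schattenSphere_iff hp).1 hca).2
  rw [schattenSum_smul hp h1, h2, mul_one, ENNReal.rpow_eq_one_iff_of_pos hp] at h3
  rw [← toReal_enorm, h3, ENNReal.toReal_one]

theorem smul_mem_schattenSphere {p : ℝ} (hp : 0 < p) {a : H →L[ℂ] H} {c : ℂ}
    (ha : a ∈ schattenSphere H p) (hc : ‖c‖ = 1) : c • a ∈ schattenSphere H p := by
  obtain ⟨h1, h2⟩ := (mem_schattenSphere_iff hp).1 ha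
  refine (mem_schattenSphere_iff hp).2 ⟨h1.smul c, ?_⟩
  rw [schattenSum_smul hp h1, h2, mul_one, ← ofReal_norm, hc]
  simp

theorem isOrtho_iff_schattenSum {p : ℝ} (hp : 0 < p) (hp2 : p ≠ 2) {x y : H →L[ℂ] H}
    (hx : x ∈ schattenSphere H p) (hy : y ∈ schattenSphere H p) :
    IsOrtho x y ↔ schattenSum p (x + y) + schattenSum p (x - y) = 2 * (1 + 1) := by
  obtain ⟨hxc, hx1⟩ := (mem_schattenSphere_iff hp).1 hx
  obtain ⟨hyc, hy1⟩ := (mem_schattenSphere_iff hp).1 hy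
  have := schattenSum_parallelogram_iff hp hp2 hxc hyc (by simp [hx1]) (by simp [hy1])
  rw [hx1, hy1] at this
  exact this.symm

end RankOne

/-! ### Consequences for a surjective isometry of the spheres. -/

section SphereIsometry

open ContinuousLinearMap InnerProductSpace

variable {H : Type*} [NormedAddCommGroup H] [InnerProductSpace ℂ H] [CompleteSpace H]
variable {H' : Type*} [NormedAddCommGroup H'] [InnerProductSpace ℂ H'] [CompleteSpace H']

theorem schattenSum_eq_of_schattenNorm_eq {p : ℝ} (hp : 0 < p) {a : H →L[ℂ] H} {b : H' →L[ℂ] H'}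
    (h : schattenNorm p a = schattenNorm p b) : schattenSum p a = schattenSum p b := by
  rw [schattenNorm_eq_schattenSum_rpow, schattenNorm_eq_schattenSum_rpow] at h
  exact ENNReal.rpow_left_injective (one_div_pos.2 hp).ne' h

theorem re_eq_and_eq_of_schattenSum_rankOne {p : ℝ} (hp : 0 < p) (hp2 : p ≠ 2) {f g u w : H}
    {f' g' u' w' : H'} (hf : ‖f‖ = 1) (hg : ‖g‖ = 1) (hu : ‖u‖ = 1) (hw : ‖w‖ = 1)
    (hf' : ‖f'‖ = 1) (hg' : ‖g'‖ = 1) (hu' : ‖u'‖ = 1) (hw' : ‖w'‖ = 1)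
    (hsub : schattenSum p (rankOne ℂ f u - rankOne ℂ g w) =
      schattenSum p (rankOne ℂ f' u' - rankOne ℂ g' w'))
    (hadd : schattenSum p (rankOne ℂ f u + rankOne ℂ g w) =
      schattenSum p (rankOne ℂ f' u' + rankOne ℂ g' w')) :
    (⟪f, g⟫_ℂ * ⟪w, u⟫_ℂ).re = (⟪f', g'⟫_ℂ * ⟪w', u'⟫_ℂ).re ∧
      (1 - ‖⟪f, g⟫_ℂ‖ ^ 2) * (1 - ‖⟪w, u⟫_ℂ‖ ^ 2) =
        (1 - ‖⟪f', g'⟫_ℂ‖ ^ 2) * (1 - ‖⟪w', u'⟫_ℂ‖ ^ 2) := by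
  obtain ⟨F, hF, hFs, hFp⟩ := exists_schattenSum_rankOne_sub hp hf hg hu hw
  obtain ⟨F', hF', hFs', hFp'⟩ := exists_schattenSum_rankOne_sub hp hf' hg' hu' hw'
  -- Replacing g by -g turns the difference into the sum: the real part changes sign and the product
  -- stays.
  obtain ⟨G, hG, hGs, hGp⟩ := exists_schattenSum_rankOne_sub hp hf
    ((norm_neg g).trans hg) hu hw
  obtain ⟨G', hG', hGs', hGp'⟩ := exists_schattenSum_rankOne_sub hp hf'
    ((norm_neg g').trans hg') hu' hw'
  simp only [map_neg, neg_apply, sub_neg_eq_add, inner_neg_right, norm_neg, neg_mul,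
    Complex.neg_re, mul_neg] at hGs hGs' hGp hGp'
  rw [hFs, hFs', ENNReal.ofReal_eq_ofReal_iff hF hF'] at hsub
  rw [hGs, hGs', ENNReal.ofReal_eq_ofReal_iff hG hG'] at hadd
  subst hsub hadd
  exact IsPowerSum.eq_and_eq (by positivity) (fun h => hp2 (by linarith)) hFp hGp hFp' hGp'

theorem map_neg_of_schattenSum {p : ℝ} (hp1 : 1 < p) {Δ : schattenSphere H p → schattenSphere H' p}
    (hN : ∀ x y : schattenSphere H p,
      schattenSum p ((Δ x : H' →L[ℂ] H') - (Δ y : H' →L[ℂ] H')) =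
        schattenSum p ((x : H →L[ℂ] H) - (y : H →L[ℂ] H)))
    {x y : schattenSphere H p} (hxy : (y : H →L[ℂ] H) = -x) :
    (Δ y : H' →L[ℂ] H') = -Δ x := by
  have hp := one_pos.trans hp1
  obtain ⟨h1, h2⟩ := (mem_schattenSphere_iff hp).1 (Δ x).2
  obtain ⟨h3, h4⟩ := (mem_schattenSphere_iff hp).1 (Δ y).2
  obtain ⟨h5, h6⟩ := (mem_schattenSphere_iff hp).1 x.2
  refine eq_neg_of_schattenSum_sub_eq hp1 h1 h3 h2 h4 ?_
  rw [hN, hxy, sub_neg_eq_add, ← two_smul ℂ, schattenSum_smul hp h5, h6, mul_one, ← ofReal_norm]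
  simp

theorem schattenSum_map_add {p : ℝ} (hp1 : 1 < p) {Δ : schattenSphere H p → schattenSphere H' p}
    (hN : ∀ x y : schattenSphere H p,
      schattenSum p ((Δ x : H' →L[ℂ] H') - (Δ y : H' →L[ℂ] H')) =
        schattenSum p ((x : H →L[ℂ] H) - (y : H →L[ℂ] H)))
    (x y : schattenSphere H p) :
    schattenSum p ((Δ x : H' →L[ℂ] H') + (Δ y : H' →L[ℂ] H')) =
      schattenSum p ((x : H →L[ℂ] H) + (y : H →L[ℂ] H)) := by
  have hmem : -(y : H →L[ℂ] H) ∈ schattenSphere H p := by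
    simpa using smul_mem_schattenSphere (one_pos.trans hp1) y.2 (c := -1) (by simp)
  have h1 := hN x ⟨_, hmem⟩
  rwa [map_neg_of_schattenSum hp1 hN (x := y) (y := ⟨_, hmem⟩) rfl, sub_neg_eq_add, sub_neg_eq_add] at h1

theorem isOrtho_map_iff {p : ℝ} (hp1 : 1 < p) (hp2 : p ≠ 2)
    {Δ : schattenSphere H p → schattenSphere H' p}
    (hN : ∀ x y : schattenSphere H p,
      schattenSum p ((Δ x : H' →L[ℂ] H') - (Δ y : H' →L[ℂ] H')) =
        schattenSum p ((x : H →L[ℂ] H) - (y : H →L[ℂ] H)))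
    (x y : schattenSphere H p) :
    IsOrtho (Δ x : H' →L[ℂ] H') (Δ y) ↔ IsOrtho (x : H →L[ℂ] H) y := by
  have hp := one_pos.trans hp1
  rw [isOrtho_iff_schattenSum hp hp2 (Δ x).2 (Δ y).2, isOrtho_iff_schattenSum hp hp2 x.2 y.2,
    hN, schattenSum_map_add hp1 hN]

/-- Maximality of the annihilator is transported by Δ: an operator annihilated by everything
orthogonal to e is a nonzero multiple of e, hence has the same annihilator. -/
theorem exists_map_eq_rankOne {p : ℝ} (hp1 : 1 < p) (hp2 : p ≠ 2)
    {Δ : schattenSphere H p → schattenSphere H' p}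
    (hN : ∀ x y : schattenSphere H p,
      schattenSum p ((Δ x : H' →L[ℂ] H') - (Δ y : H' →L[ℂ] H')) =
        schattenSum p ((x : H →L[ℂ] H) - (y : H →L[ℂ] H)))
    (hsurj : Function.Surjective Δ) {e : schattenSphere H p} {f u : H} (hf : ‖f‖ = 1)
    (hu : ‖u‖ = 1) (he : (e : H →L[ℂ] H) = rankOne ℂ f u) :
    ∃ f' u' : H', ‖f'‖ = 1 ∧ ‖u'‖ = 1 ∧ (Δ e : H' →L[ℂ] H') = rankOne ℂ f' u' := by
  have hp := one_pos.trans hp1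
  refine exists_eq_rankOne_of_isOrtho_maximal hp (Δ e).2 fun b' hb' hmax c' hc' hbc => ?_
  obtain ⟨b, hb⟩ := hsurj ⟨b', hb'⟩
  obtain ⟨c, hc⟩ := hsurj ⟨c', hc'⟩
  obtain rfl : (Δ b : H' →L[ℂ] H') = b' := congrArg Subtype.val hb
  obtain rfl : (Δ c : H' →L[ℂ] H') = c' := congrArg Subtype.val hc
  obtain ⟨l, hl⟩ := exists_eq_smul_of_isOrtho_imp hp hf hu (b := b) fun d hd hed => by
    have := hmax (Δ ⟨d, hd⟩) (Δ ⟨d, hd⟩).2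
      ((isOrtho_map_iff hp1 hp2 hN _ _).2 (by rw [he]; exact hed))
    exact (isOrtho_map_iff hp1 hp2 hN b ⟨d, hd⟩).1 this
  have hl1 : ‖l‖ = 1 := norm_eq_one_of_smul_mem_schattenSphere hp
    (rankOne_mem_schattenSphere hp hf hu) (hl ▸ b.2)
  have hl0 : l ≠ 0 := fun h => by simp [h] at hl1
  rw [isOrtho_map_iff hp1 hp2 hN] at hbc ⊢
  rw [hl, isOrtho_smul_iff hl0] at hbc
  rwa [he]

/-- The image of `i e` is `± i` times the image of `e`. -/
theorem exists_map_I_smul_eq {p : ℝ} (hp1 : 1 < p) (hp2 : p ≠ 2)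
    {Δ : schattenSphere H p → schattenSphere H' p}
    (hN : ∀ x y : schattenSphere H p,
      schattenSum p ((Δ x : H' →L[ℂ] H') - (Δ y : H' →L[ℂ] H')) =
        schattenSum p ((x : H →L[ℂ] H) - (y : H →L[ℂ] H)))
    (hsurj : Function.Surjective Δ) {e d : schattenSphere H p} {f u : H} {f' u' : H'}
    (hf : ‖f‖ = 1) (hu : ‖u‖ = 1) (he : (e : H →L[ℂ] H) = rankOne ℂ f u)
    (hd : (d : H →L[ℂ] H) = rankOne ℂ (Complex.I • f) u)
    (hf' : ‖f'‖ = 1) (hu' : ‖u'‖ = 1) (he' : (Δ e : H' →L[ℂ] H') = rankOne ℂ f' u') :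
    ∃ l : ℂ, (l = Complex.I ∨ l = -Complex.I) ∧
      (Δ d : H' →L[ℂ] H') = rankOne ℂ (l • f') u' := by
  have hp := one_pos.trans hp1
  have hde : (d : H →L[ℂ] H) = Complex.I • (e : H →L[ℂ] H) := by
    rw [hd, he, map_smul, smul_apply]
  obtain ⟨l, hl⟩ := exists_eq_smul_of_isOrtho_imp hp hf' hu' (b := Δ d) fun c' hc' hec => by
    obtain ⟨c, hc⟩ := hsurj ⟨c', hc'⟩
    obtain rfl : (Δ c : H' →L[ℂ] H') = c' := congrArg Subtype.val hc
    rw [← he', isOrtho_map_iff hp1 hp2 hN] at hec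
    rwa [isOrtho_map_iff hp1 hp2 hN, hde, isOrtho_smul_iff Complex.I_ne_zero]
  have hl1 : ‖l‖ = 1 := norm_eq_one_of_smul_mem_schattenSphere hp
    (rankOne_mem_schattenSphere hp hf' hu') (hl ▸ (Δ d).2)
  have hdl : (Δ d : H' →L[ℂ] H') = rankOne ℂ (l • f') u' := by
    rw [hl, map_smul, smul_apply]
  refine ⟨l, ?_, hdl⟩
  -- The invariant real part for the pair e, ie gives Re l = Re i = 0, which with |l| = 1 leaves ±i.
  have hre := (re_eq_and_eq_of_schattenSum_rankOne hp hp2 hf (g := Complex.I • f)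
    (by simp [norm_smul, hf]) hu hu hf' (g' := l • f') (by simp [norm_smul, hf', hl1]) hu' hu'
    (by rw [← he, ← hd, ← he', ← hdl, hN])
    (by rw [← he, ← hd, ← he', ← hdl, schattenSum_map_add hp1 hN])).1
  rw [inner_smul_right, inner_smul_right, inner_self_eq_one_of_norm_eq_one hf,
    inner_self_eq_one_of_norm_eq_one hu, inner_self_eq_one_of_norm_eq_one hf',
    inner_self_eq_one_of_norm_eq_one hu', mul_one, mul_one, mul_one, mul_one, Complex.I_re] at hre
  have him : l.im ^ 2 = 1 := by
    have h1 := Complex.sq_norm l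
    rw [hl1, Complex.normSq_apply, ← hre] at h1
    linarith
  rcases sq_eq_sq_iff_eq_or_eq_neg.1 (him.trans (one_pow 2).symm) with h | h
  · exact Or.inl (Complex.ext (by simp [← hre]) (by simp [h]))
  · exact Or.inr (Complex.ext (by simp [← hre]) (by simp [h]))

end SphereIsometry

end

theorem propositionp
    {H : Type*} [NormedAddCommGroup H] [InnerProductSpace ℂ H] [CompleteSpace H]
    {H' : Type*} [NormedAddCommGroup H'] [InnerProductSpace ℂ H'] [CompleteSpace H']
    (p : ℝ) (hp1 : 1 < p) (hp2 : p ≠ 2)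
    (Δ : schattenSphere H p → schattenSphere H' p)
    (hiso : ∀ x y : schattenSphere H p,
      schattenNorm p ((Δ x : H' →L[ℂ] H') - (Δ y : H' →L[ℂ] H')) =
        schattenNorm p ((x : H →L[ℂ] H) - (y : H →L[ℂ] H)))
    (hsurj : Function.Surjective Δ)
    (e v : schattenSphere H p)
    (he : IsMinimalPartialIsometry (e : H →L[ℂ] H))
    (hv : IsMinimalPartialIsometry (v : H →L[ℂ] H)) :
    IsMinimalPartialIsometry (Δ e : H' →L[ℂ] H') ∧
    (peirceTwo (Δ e : H' →L[ℂ] H') (Δ v : H' →L[ℂ] H') =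
        peirceCoeff (e : H →L[ℂ] H) (v : H →L[ℂ] H) • (Δ e : H' →L[ℂ] H') ∨
      peirceTwo (Δ e : H' →L[ℂ] H') (Δ v : H' →L[ℂ] H') =
        (starRingEnd ℂ) (peirceCoeff (e : H →L[ℂ] H) (v : H →L[ℂ] H)) •
          (Δ e : H' →L[ℂ] H')) ∧
    (peirceCoeff (Δ e : H' →L[ℂ] H') (Δ v : H' →L[ℂ] H') =
        peirceCoeff (e : H →L[ℂ] H) (v : H →L[ℂ] H) ∨
      peirceCoeff (Δ e : H' →L[ℂ] H') (Δ v : H' →L[ℂ] H') =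
        (starRingEnd ℂ) (peirceCoeff (e : H →L[ℂ] H) (v : H →L[ℂ] H))) ∧
    schattenNorm p (peirceZero (Δ e : H' →L[ℂ] H') (Δ v : H' →L[ℂ] H')) =
      schattenNorm p (peirceZero (e : H →L[ℂ] H) (v : H →L[ℂ] H)) := by
  have hp := one_pos.trans hp1
  have hN : ∀ x y : schattenSphere H p,
      schattenSum p ((Δ x : H' →L[ℂ] H') - (Δ y : H' →L[ℂ] H')) =
        schattenSum p ((x : H →L[ℂ] H) - (y : H →L[ℂ] H)) :=
    fun x y => schattenSum_eq_of_schattenNorm_eq hp (hiso x y)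
  obtain ⟨f, u, hf, hu, hfu⟩ := he.exists_eq_rankOne
  obtain ⟨g, w, hg, hw, hgw⟩ := hv.exists_eq_rankOne
  obtain ⟨f', u', hf', hu', hfu'⟩ := exists_map_eq_rankOne hp1 hp2 hN hsurj hf hu hfu
  obtain ⟨g', w', hg', hw', hgw'⟩ := exists_map_eq_rankOne hp1 hp2 hN hsurj hg hw hgw
  have hmin : IsMinimalPartialIsometry (Δ e : H' →L[ℂ] H') := by
    rw [hfu']
    exact isMinimalPartialIsometry_rankOne hf' hu'
  have hIf : ‖Complex.I • f‖ = 1 := by rw [norm_smul, Complex.norm_I, hf, one_mul]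
  obtain ⟨l, hl, hd⟩ := exists_map_I_smul_eq hp1 hp2 hN hsurj
    (d := ⟨_, rankOne_mem_schattenSphere hp hIf hu⟩) hf hu hfu rfl hf' hu' hfu'
  obtain ⟨hre, hD⟩ := re_eq_and_eq_of_schattenSum_rankOne hp hp2 hf hg hu hw hf' hg' hu' hw'
    (by rw [← hfu, ← hgw, ← hfu', ← hgw', hN])
    (by rw [← hfu, ← hgw, ← hfu', ← hgw', schattenSum_map_add hp1 hN])
  have hlf : ‖l • f'‖ = 1 := by
    rw [norm_smul, hf', mul_one]
    rcases hl with rfl | rfl <;> simp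
  -- The coefficient of v along ie is -iφ_e(v), whose real part is Im φ_e(v); the choice l = i or l
  -- = -i decides between φ_e(v) and its conjugate.
  obtain ⟨him, -⟩ := re_eq_and_eq_of_schattenSum_rankOne hp hp2 hIf hg hu hw hlf hg' hu' hw'
    (by rw [← hd, ← hgw, ← hgw', hN])
    (by rw [← hd, ← hgw, ← hgw', schattenSum_map_add hp1 hN])
  have hcoeff : peirceCoeff (Δ e : H' →L[ℂ] H') (Δ v : H' →L[ℂ] H') =
        peirceCoeff (e : H →L[ℂ] H) (v : H →L[ℂ] H) ∨
      peirceCoeff (Δ e : H' →L[ℂ] H') (Δ v : H' →L[ℂ] H') =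
        (starRingEnd ℂ) (peirceCoeff (e : H →L[ℂ] H) (v : H →L[ℂ] H)) := by
    rw [hfu, hgw, hfu', hgw', peirceCoeff_rankOne hf hu, peirceCoeff_rankOne hf' hu']
    rw [inner_smul_left, inner_smul_left, mul_assoc, mul_assoc] at him
    generalize inner ℂ f g * inner ℂ w u = α at hre him ⊢
    generalize inner ℂ f' g' * inner ℂ w' u' = β at hre him ⊢
    rcases hl with rfl | rfl
    · exact Or.inl (Complex.ext hre.symm (by simpa using him.symm))
    · refine Or.inr (Complex.ext (by simpa using hre.symm) ?_)
      have : α.im = -β.im := by simpa using him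
      simp [this]
  refine ⟨hmin, ?_, hcoeff, ?_⟩
  · rw [peirceTwo_eq_peirceCoeff_smul hmin]
    exact hcoeff.imp (congrArg (· • _)) (congrArg (· • _))
  · rw [schattenNorm_eq_schattenSum_rpow, schattenNorm_eq_schattenSum_rpow, hfu, hgw, hfu', hgw',
      schattenSum_peirceZero_rankOne hp hf hu hg hw,
      schattenSum_peirceZero_rankOne hp hf' hu' hg' hw', hD]
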